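/- Let $d\ge 2$, $q\ge 2$ and $m_1\ge m_2\ge\cdots\ge m_d\ge 2$ be integers, let $\Sigma=\big(\prod_{k=1}^d\{0,\dots,m_k-1\}\big)^{\mathbb N^*}$, and write $x_i^k$ for the $k$-th coordinate of the $i$-th term of $x\in\Sigma$. Equip $\Sigma$ with the metric $\mathrm{dist}(x,y)=\max_{1\le k\le d} m_k^{-\min\{i\ge 0\,:\,x_{i+1}^k\ne y_{i+1}^k\}}$ (the $k$-th term being $0$ if $x^k=y^k$). Let $\Omega\subset\Sigma$ be closed and non-empty and let $$X_\Omega=\{x\in\Sigma : (x_{iq^\ell})_{\ell\ge 0}\in\Omega\ \text{ for all } i\ge 1 \text{ with } q\nmid i\}.$$ For $n_1,\dots,n_d\in\mathbb N$ let $\mathrm{Pref}_{n_1,\dots,n_d}(\Omega)$ be the set of families $\big(x_i^k\big)_{1\le k\le d,\ 1\le i\le n_1+\cdots+n_k}$, $x\in\Omega$ (that is, one reads coordinates $1,\dots,d$ at the first $n_1$ positions, then coordinates $2,\dots,d$ at the next $n_2$ positions, and so on, and finally coordinate $d$ at the last $n_d$ positions). Parameters. For $2\le k\le d$ put $\gamma_k=\log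 m_k/\log m_{k-1}$ and $L_k(n)=\lceil n/\gamma_k\rceil$, and let $L_1(n)=n$. Let $j_d$ be the integer with $q^{j_d}\le 1/\gamma_d<q^{j_d+1}$ and, for $1\le t\le d-1$, let $p_t$ be the integer with $q^{p_t}\le \frac1{\gamma_d\gamma_{d-1}\cdots\gamma_{t+1}}<q^{p_t+1}$. For $1\le s\le d-1$ there is a permutation $\sigma_s$ of $\{s,\dots,d-1\}$ such that, for all large $n$ and all $p\ge 0$, the sequence $\Big(\frac{L_{\sigma_s(t)}\circ\cdots\circ L_1(n)}{q^{\,p-p_{\sigma_s(t)}-1}}\Big)_{s\le t\le d-1}$ is non-decreasing; fix any such $\sigma_s$. For $s-1\le t\le d-1$ and $s\le k\le d-1$ let $p_k^{s,t}=p_k+1$ if $k\in\sigma_s(\{s,\dots,t\})$ and $p_k^{s,t}=p_k$ otherwise. With $w_{s,t}=q^{p_{\sigma_s(t)}}\prod_{i=\sigma_s(t)+1}^{d}\gamma_i$ for $s\le t\le d-1$ let, for $p\ge 1$, $$\delta_p^{d,d-1}=\frac{(q-1)^2}{q^{p+1}},\qquad \delta_p^{s,s-1}=\frac{(q\,w_{s,s}-1)(q-1)}{q^{p+1}},$$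 $$\delta_p^{s,t}=\frac{(w_{s,t+1}-w_{s,t})(q-1)}{q^{p}}\ (s\le t\le d-2),\qquad \delta_p^{s,d-1}=\frac{(1-w_{s,d-1})(q-1)}{q^{p}} .$$ Theorem. The set $X_\Omega$ is totally bounded, its Minkowski (box-counting) dimension exists, that is, $\log N(\varepsilon)/\log(1/\varepsilon)$ has a limit as $\varepsilon\to0^+$, where $N(\varepsilon)$ is the least number of closed $\varepsilon$-balls covering $X_\Omega$, and \begin{align*} \dim_M(X_\Omega)&=\sum_{p=1}^{j_d}\delta_p^{d,d-1}\log_{m_d}\big|\mathrm{Pref}_{0,\dots,0,p}(\Omega)\big|\\ &+\sum_{s=2}^{d-1}\ \sum_{p=p_s+1}^{p_{s-1}}\ \sum_{t=s-1}^{d-1}\delta_p^{s,t}\log_{m_d}\big|\mathrm{Pref}_{0,\dots,0,\,p-p_s^{s,t},\,p_s^{s,t}-p_{s+1}^{s,t},\dots,\,p_{d-2}^{s,t}-p_{d-1}^{s,t},\,p_{d-1}^{s,t}}(\Omega)\big|\\ &+\sum_{p=p_1+1}^{\infty}\ \sum_{t=0}^{d-1}\delta_p^{1,t}\log_{m_d}\big|\mathrm{Pref}_{p-p_1^{1,t},\,p_1^{1,t}-p_2^{1,t},\dots,\,p_{d-2}^{1,t}-p_{d-1}^{1,t},\,p_{d-1}^{1,t}}(\Omega)\big|,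 \end{align*} where the series converges, and where a term with $\delta_p^{s,t}=0$ is read as $0$ (a negative index can occur only in such a term). -/

import Mathlib

open Filter Topology
open scoped NNReal

noncomputable section

namespace MulSponge

/-! ### The symbolic space and its metric -/

/-- The symbolic space `Σ_{m_1,…,m_d} = (A_1 × ⋯ × A_d)^{ℕ*}`, where `A_k = {0,…,m_k - 1}`.
For `x : DigitSeq d m`, the digit `x_i^k` is `x i k`. Only `m 1, …, m d` matter. -/
def DigitSeq (d : ℕ) (m : ℕ → ℕ) : Type :=
  ℕ+ → (k : Finset.Icc 1 d) → Fin (m k)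

variable {d : ℕ} {m : ℕ → ℕ}

/-- `m_k ^ (- min {i ≥ 0 : x_{i+1}^k ≠ y_{i+1}^k})`, which is `0` if `x^k = y^k`. -/
def coordDist (x y : DigitSeq d m) (k : Finset.Icc 1 d) : ℝ :=
  open Classical in
  if ∀ i, x i k = y i k then 0
  else ((m k : ℝ)⁻¹) ^ sInf {i : ℕ | x i.succPNat k ≠ y i.succPNat k}

theorem coordDist_nonneg (x y : DigitSeq d m) (k : Finset.Icc 1 d) : 0 ≤ coordDist x y k := by
  unfold coordDist
  split_ifs
  · exact le_rfl
  · positivity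

theorem coordDist_self (x : DigitSeq d m) (k : Finset.Icc 1 d) : coordDist x x k = 0 := by
  simp [coordDist]

theorem coordDist_comm (x y : DigitSeq d m) (k : Finset.Icc 1 d) :
    coordDist x y k = coordDist y x k := by
  have hs : {i : ℕ | x i.succPNat k ≠ y i.succPNat k} = {i : ℕ | y i.succPNat k ≠ x i.succPNat k} :=
    Set.ext fun i => ne_comm
  unfold coordDist
  rw [hs]
  by_cases h : ∀ i, x i k = y i k
  · rw [if_pos h, if_pos fun i => (h i).symm]
  · rw [if_neg h, if_neg fun h' => h fun i => (h' i).symm]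

theorem coordDist_eq_zero {x y : DigitSeq d m} {k : Finset.Icc 1 d} (h : coordDist x y k = 0) :
    ∀ i, x i k = y i k := by
  by_contra hne
  rw [coordDist, if_neg hne] at h
  have hm : (m k : ℝ) ≠ 0 := by exact_mod_cast (x 1 k).pos.ne'
  exact absurd h (pow_ne_zero _ (inv_ne_zero hm))

theorem coordDist_le_max (x y z : DigitSeq d m) (k : Finset.Icc 1 d) :
    coordDist x z k ≤ max (coordDist x y k) (coordDist y z k) := by
  by_cases hxz : ∀ i, x i k = z i k
  · rw [coordDist, if_pos hxz]
    exact le_max_of_le_left (coordDist_nonneg _ _ _)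
  by_cases hxy : ∀ i, x i k = y i k
  · refine le_max_of_le_right (le_of_eq ?_)
    have hyz : ¬ ∀ i, y i k = z i k := fun h => hxz fun i => (hxy i).trans (h i)
    simp only [coordDist, if_neg hxz, if_neg hyz, hxy]
  by_cases hyz : ∀ i, y i k = z i k
  · refine le_max_of_le_left (le_of_eq ?_)
    simp only [coordDist, if_neg hxz, if_neg hxy, hyz]
  have hm : (1 : ℝ) ≤ m k := by exact_mod_cast (x 1 k).pos
  have h0 : (0 : ℝ) ≤ (m k : ℝ)⁻¹ := by positivity
  have h1 : (m k : ℝ)⁻¹ ≤ 1 := inv_le_one_of_one_le₀ hm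
  have hne : {i : ℕ | x i.succPNat k ≠ z i.succPNat k}.Nonempty := by
    push Not at hxz
    obtain ⟨i, hi⟩ := hxz
    exact ⟨i.natPred, by simpa using hi⟩
  have hmem := Nat.sInf_mem hne
  set N := sInf {i : ℕ | x i.succPNat k ≠ z i.succPNat k} with hN
  simp only [coordDist, if_neg hxz, if_neg hxy, if_neg hyz]
  by_cases hx : x N.succPNat k = y N.succPNat k
  · refine le_max_of_le_right (pow_le_pow_of_le_one h0 h1 (Nat.sInf_le ?_))
    intro hy
    exact hmem (hx.trans hy)
  · exact le_max_of_le_left (pow_le_pow_of_le_one h0 h1 (Nat.sInf_le hx))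

/-- The metric `d(x, y) = max_k m_k ^ (- min {i ≥ 0 : x_{i+1}^k ≠ y_{i+1}^k})`.
As `m_k = m_1 ^ (γ_2 ⋯ γ_k)`, the closed ball of radius `m_1 ^ (-n)` about `x` consists of those `y`
that have the same first `⌈n / (γ_2 ⋯ γ_k)⌉` digits as `x` in the `k`-th coordinate, for each `k`;
as `m_1 ≥ ⋯ ≥ m_d`, comparing the tuples `(x^k, …, x^d)` in the place of `x^k` gives the same
metric. -/
instance : MetricSpace (DigitSeq d m) where
  dist x y := ⨆ k, coordDist x y k
  dist_self x := by simp [coordDist_self]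
  dist_comm x y := by simp only [coordDist_comm]
  dist_triangle x y z := by
    have hb : ∀ a b : DigitSeq d m, BddAbove (Set.range (coordDist a b)) :=
      fun a b => (Set.finite_range _).bddAbove
    have hn : ∀ a b : DigitSeq d m, 0 ≤ ⨆ k, coordDist a b k :=
      fun a b => Real.iSup_nonneg (coordDist_nonneg a b)
    refine Real.iSup_le (fun k => ?_) (add_nonneg (hn x y) (hn y z))
    refine (coordDist_le_max x y z k).trans (max_le ?_ ?_)
    · exact (le_ciSup (hb x y) k).trans (le_add_of_nonneg_right (hn y z))
    · exact (le_ciSup (hb y z) k).trans (le_add_of_nonneg_left (hn x y))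
  eq_of_dist_eq_zero {x y} h := by
    funext i k
    have hb : BddAbove (Set.range (coordDist x y)) := (Set.finite_range _).bddAbove
    exact coordDist_eq_zero (le_antisymm ((le_ciSup hb k).trans h.le) (coordDist_nonneg x y k)) i

/-- `A` has Minkowski (box-counting) dimension `D`: it is totally bounded and the limit of
`log N(ε) / log (1 / ε)` as `ε → 0` exists and is `D`, where `N(ε)` is the least number of closed
balls of radius `ε` that cover `A`. -/
def HasMinkowskiDim {X : Type*} [PseudoMetricSpace X] (A : Set X) (D : ℝ) : Prop :=
  TotallyBounded A ∧
    Tendsto (fun ε : ℝ≥0 => Real.log ((Metric.coveringNumber ε A).toNat : ℝ) / Real.log (1 / (ε : ℝ)))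
      (𝓝[>] 0) (𝓝 D)

/-! ### The sets `X_Ω` and the prefixes of `Ω` -/

/-- `X_Ω = {x : (x_{i q^ℓ})_{ℓ ≥ 0} ∈ Ω for all i with q ∤ i}`; the term of index `ℓ ≥ 0` of the
subsequence is its digit at position `ℓ + 1`. -/
def mulSet (q : ℕ+) (Ω : Set (DigitSeq d m)) : Set (DigitSeq d m) :=
  {x | ∀ i : ℕ+, ¬ (q : ℕ) ∣ (i : ℕ) → (fun n : ℕ+ => x (i * q ^ n.natPred) : DigitSeq d m) ∈ Ω}

/-- The places read by a prefix of size `(n_1, …, n_d)`: first `n_1` positions with the coordinates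
`1, …, d`, then `n_2` positions with the coordinates `2, …, d`, and so on, finally `n_d` positions
with the coordinate `d` only. Coordinate `k` is thus read at the positions
`1, …, n_1 + ⋯ + n_k`. -/
def prefPlaces (d : ℕ) (n : ℕ → ℕ) : Set (ℕ+ × Finset.Icc 1 d) :=
  {c | (c.1 : ℕ) ≤ ∑ i ∈ Finset.Icc 1 (c.2 : ℕ), n i}

/-- `Pref_{n_1,…,n_d}(Ω)`, the set of prefixes of size `(n_1, …, n_d)` of the points of `Ω`. -/
def pref (n : ℕ → ℕ) (Ω : Set (DigitSeq d m)) :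
    Set ((c : prefPlaces d n) → Fin (m c.1.2)) :=
  (fun x c => x c.1.1 c.1.2) '' Ω

/-! ### The parameters -/

/-- `γ_k = log m_k / log m_{k-1}`, for `2 ≤ k ≤ d`. -/
def gam (m : ℕ → ℕ) (k : ℕ) : ℝ := Real.log (m k) / Real.log (m (k - 1))

/-- `γ_{k+1} γ_{k+2} ⋯ γ_d`, for `1 ≤ k ≤ d` (so it is `1` for `k = d`). -/
def gamProd (d : ℕ) (m : ℕ → ℕ) (k : ℕ) : ℝ := ∏ i ∈ Finset.Icc (k + 1) d, gam m i

/-- The map `L_k : n ↦ ⌈n / γ_k⌉` for `2 ≤ k ≤ d`, and the identity for `k = 1`. -/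
def scaleMap (m : ℕ → ℕ) (k n : ℕ) : ℕ := if k = 1 then n else ⌈(n : ℝ) / gam m k⌉₊

/-- `(L_k ∘ ⋯ ∘ L_1)(n)`. -/
def scaleComp (m : ℕ → ℕ) : ℕ → ℕ → ℕ
  | 0, n => n
  | k + 1, n => scaleMap m (k + 1) (scaleComp m k n)

/-- `j_t`, for `2 ≤ t ≤ d`: the integer with `q ^ j_t ≤ 1 / γ_t < q ^ (j_t + 1)`. -/
def jPar (m : ℕ → ℕ) (q : ℕ+) (t : ℕ) : ℕ := ⌊Real.logb (q : ℕ) (1 / gam m t)⌋₊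

/-- `p_t`, for `1 ≤ t ≤ d - 1`: the integer with
`q ^ p_t ≤ 1 / (γ_d γ_{d-1} ⋯ γ_{t+1}) < q ^ (p_t + 1)`. It is `0` for `t = d`. -/
def pPar (d : ℕ) (m : ℕ → ℕ) (q : ℕ+) (t : ℕ) : ℕ := ⌊Real.logb (q : ℕ) (1 / gamProd d m t)⌋₊

/-- `τ` is a permutation of `{s, …, d - 1}` (extended by the identity) such that, for all large `n`
and all `p`, the sequence `L_{τ(t)} ∘ ⋯ ∘ L_1 (n) / q ^ (p - p_{τ(t)} - 1)`, `t = s, …, d - 1`, is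
non-decreasing. -/
structure IsOrdering (d : ℕ) (m : ℕ → ℕ) (q : ℕ+) (s : ℕ) (τ : Equiv.Perm ℕ) : Prop where
  fix : ∀ k, k ∉ Finset.Icc s (d - 1) → τ k = k
  mono : ∀ᶠ n : ℕ in atTop, ∀ p : ℕ, MonotoneOn
    (fun t : ℕ => (scaleComp m (τ t) n : ℝ) /
      ((q : ℕ) : ℝ) ^ ((p : ℤ) - (pPar d m q (τ t) : ℤ) - 1))
    (Set.Icc s (d - 1))

/-- `p_k^{s,t}`, which is `p_k + 1` if `k ∈ σ_s({s, …, t})` and `p_k` otherwise. -/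
def pST (d : ℕ) (m : ℕ → ℕ) (q : ℕ+) (σ : ℕ → Equiv.Perm ℕ) (s t k : ℕ) : ℕ :=
  if k ∈ (Finset.Icc s t).image (σ s) then pPar d m q k + 1 else pPar d m q k

/-- The weights `δ_p^{s,t}`, for `1 ≤ s ≤ d - 1` and `s - 1 ≤ t ≤ d - 1`. -/
def delta (d : ℕ) (m : ℕ → ℕ) (q : ℕ+) (σ : ℕ → Equiv.Perm ℕ) (s t p : ℕ) : ℝ :=
  let Q : ℝ := (q : ℕ)
  let w : ℕ → ℝ := fun u => Q ^ pPar d m q (σ s u) * gamProd d m (σ s u)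
  if t + 1 = s then (Q * w s - 1) * (Q - 1) / Q ^ (p + 1)
  else if t = d - 1 then (1 - w (d - 1)) * (Q - 1) / Q ^ p
  else (w (t + 1) - w t) * (Q - 1) / Q ^ p

/-- The weight `δ_p^{d,d-1} = (q - 1)² / q ^ (p + 1)`. -/
def deltaTop (q : ℕ+) (p : ℕ) : ℝ := (((q : ℕ) : ℝ) - 1) ^ 2 / ((q : ℕ) : ℝ) ^ (p + 1)

/-- The size `(0, …, 0, p)`. -/
def sizeTop (d p : ℕ) : ℕ → ℕ := fun k => if k = d then p else 0

/-- The size `(0, …, 0, p - p_s^{s,t}, p_s^{s,t} - p_{s+1}^{s,t}, …, p_{d-2}^{s,t} - p_{d-1}^{s,t},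
p_{d-1}^{s,t})`, where `p - p_s^{s,t}` is the `s`-th entry and `1 ≤ s ≤ d - 1`. An entry can be
negative (and then is truncated) only if the corresponding weight `δ_p^{s,t}` is `0`. -/
def sizeST (d : ℕ) (m : ℕ → ℕ) (q : ℕ+) (σ : ℕ → Equiv.Perm ℕ) (s t p : ℕ) : ℕ → ℕ := fun k =>
  if k < s then 0
  else if k = s then p - pST d m q σ s t s
  else if k = d then pST d m q σ s t (d - 1)
  else pST d m q σ s t (k - 1) - pST d m q σ s t k

/-- `∑_{t=s-1}^{d-1} δ_p^{s,t} log_{m_d} |Pref_{0,…,0,p-p_s^{s,t},…,p_{d-1}^{s,t}}(Ω)|`. -/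
def levelSum (q : ℕ+) (σ : ℕ → Equiv.Perm ℕ) (Ω : Set (DigitSeq d m)) (s p : ℕ) : ℝ :=
  ∑ t ∈ Finset.Icc (s - 1) (d - 1),
    delta d m q σ s t p * Real.logb (m d) ((pref (sizeST d m q σ s t p) Ω).ncard : ℝ)

end MulSponge

end

open MulSponge

namespace MulSponge

variable {d : ℕ} {m : ℕ → ℕ} {q : ℕ+}

/-! ### Parameters -/

/-! Put `T = log (1 / ε) / log m_d` and `g_k = γ_{k+1} ⋯ γ_d = log m_d / log m_k`. A closed `ε`-ball
fixes exactly the first `⌈g_k T⌉` digits of each coordinate `k`, so closed balls are the fibres of a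
restriction map and the covering number of `X_Ω` is the number of values of that map
(`coveringNumber_eq_encard_image`). Every positive integer is uniquely `i q^e` with `q ∤ i`, and the
defining condition of `X_Ω` constrains each progression `(i q^e)_e` separately. The count is
therefore a product over `i` (`coveringNumber_mulSet`), and its logarithm is a sum of weights.

The weight of `i` depends only on which inequalities `i q^e ≤ ⌈g_k T⌉` hold. Up to one boundary
integer, the pattern is constant while `i / T` stays in an interval `(a, b]` with no number `g_k
q^(-e)` in its interior. As the integers prime to divisibility by `q` have density `1 - 1/q`, such a
cell contributes `(b - a)(1 - 1/q)` times the logarithm of one prefix count (`tendsto_cell`).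

The level `(q^(-p), q^(1-p)]` contains a number `g_k q^(-e)` exactly when `p_k < p`, and then it is
`q w_k q^(-p)` with `w_k = q^(p_k) g_k ∈ (1/q, 1]`. For `p_s < p ≤ p_{s-1}` the coordinates
concerned below `d` are `s, …, d - 1`, and `σ_s` lists them by increasing `w_k`. This gives the
weights `δ_p^{s,t}` and the prefix sizes (`delta_eq`, `cell_bounds`). For `p ≤ p_{d-1}` only
coordinate `d` is read.

Finally the levels are summed by dominated convergence: level `p` has about `q^(-p) T` integers,
each of weight `O(p)` (`tendsto_sum_weight`). -/

theorem log_digits_pos (hm : ∀ k ∈ Finset.Icc 1 d, 2 ≤ m k) {k : ℕ} (h1 : 1 ≤ k) (hk : k ≤ d) :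
    0 < Real.log (m k) :=
  Real.log_pos (by exact_mod_cast hm k (Finset.mem_Icc.2 ⟨h1, hk⟩))

theorem gamProd_eq (hm : ∀ k ∈ Finset.Icc 1 d, 2 ≤ m k) {k : ℕ} (h1 : 1 ≤ k) (hk : k ≤ d) :
    gamProd d m k = Real.log (m d) / Real.log (m k) := by
  have key : ∀ n, k ≤ n → n ≤ d →
      ∏ i ∈ Finset.Icc (k + 1) n, gam m i = Real.log (m n) / Real.log (m k) := by
    intro n hn
    induction n, hn using Nat.le_induction with
    | base =>
      intro _
      rw [Finset.Icc_eq_empty (by omega), Finset.prod_empty,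
        div_self (log_digits_pos hm h1 hk).ne']
    | succ n hn ih =>
      intro hnd
      rw [Finset.prod_Icc_succ_top (by omega), ih (by omega), gam, Nat.add_sub_cancel]
      have := (log_digits_pos hm (k := n) (by omega) (by omega)).ne'
      field_simp
  exact key d hk le_rfl

theorem log_digits_anti (hm : ∀ k ∈ Finset.Icc 1 d, 2 ≤ m k) (hanti : AntitoneOn m (Set.Icc 1 d))
    {k l : ℕ} (h1 : 1 ≤ k) (hkl : k ≤ l) (hl : l ≤ d) : Real.log (m l) ≤ Real.log (m k) := by
  apply Real.log_le_log
  · have := hm l (Finset.mem_Icc.2 ⟨h1.trans hkl, hl⟩)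
    exact_mod_cast (by omega : 0 < m l)
  · exact_mod_cast hanti ⟨h1, hkl.trans hl⟩ ⟨h1.trans hkl, hl⟩ hkl

theorem gamProd_pos (hm : ∀ k ∈ Finset.Icc 1 d, 2 ≤ m k) {k : ℕ} (h1 : 1 ≤ k) (hk : k ≤ d) :
    0 < gamProd d m k := by
  rw [gamProd_eq hm h1 hk]
  exact div_pos (log_digits_pos hm (h1.trans hk) le_rfl) (log_digits_pos hm h1 hk)

theorem gamProd_mono (hm : ∀ k ∈ Finset.Icc 1 d, 2 ≤ m k) (hanti : AntitoneOn m (Set.Icc 1 d))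
    {k l : ℕ} (h1 : 1 ≤ k) (hkl : k ≤ l) (hl : l ≤ d) : gamProd d m k ≤ gamProd d m l := by
  rw [gamProd_eq hm h1 (hkl.trans hl), gamProd_eq hm (h1.trans hkl) hl]
  exact div_le_div_of_nonneg_left (log_digits_pos hm (h1.trans (hkl.trans hl)) le_rfl).le
    (log_digits_pos hm (h1.trans hkl) hl) (log_digits_anti hm hanti h1 hkl hl)

theorem gamProd_self (d : ℕ) (m : ℕ → ℕ) : gamProd d m d = 1 := by
  simp [gamProd]

theorem gamProd_le_one (hm : ∀ k ∈ Finset.Icc 1 d, 2 ≤ m k) (hanti : AntitoneOn m (Set.Icc 1 d))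
    {k : ℕ} (h1 : 1 ≤ k) (hk : k ≤ d) : gamProd d m k ≤ 1 :=
  (gamProd_mono hm hanti h1 hk le_rfl).trans_eq (gamProd_self d m)

/-- The normalised scale `q ^ p_k γ_{k+1} ⋯ γ_d`, which lies in `(1 / q, 1]`. -/
noncomputable def wPar (d : ℕ) (m : ℕ → ℕ) (q : ℕ+) (k : ℕ) : ℝ :=
  ((q : ℕ) : ℝ) ^ pPar d m q k * gamProd d m k

theorem wPar_le_one (hm : ∀ k ∈ Finset.Icc 1 d, 2 ≤ m k) (hanti : AntitoneOn m (Set.Icc 1 d))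
    (hq : 2 ≤ (q : ℕ)) {k : ℕ} (h1 : 1 ≤ k) (hk : k ≤ d) : wPar d m q k ≤ 1 := by
  have hg := gamProd_pos hm h1 hk
  have hQ : (1 : ℝ) < ((q : ℕ) : ℝ) := by exact_mod_cast hq
  have h0 : 0 ≤ Real.logb (q : ℕ) (1 / gamProd d m k) :=
    Real.logb_nonneg hQ ((one_le_div hg).2 (gamProd_le_one hm hanti h1 hk))
  have := Nat.floor_le h0
  rw [Real.le_logb_iff_rpow_le hQ (by positivity), Real.rpow_natCast] at this
  rwa [wPar, ← le_div_iff₀ hg]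

theorem one_lt_mul_wPar (hm : ∀ k ∈ Finset.Icc 1 d, 2 ≤ m k)
    (hq : 2 ≤ (q : ℕ)) {k : ℕ} (h1 : 1 ≤ k) (hk : k ≤ d) : 1 < ((q : ℕ) : ℝ) * wPar d m q k := by
  have hg := gamProd_pos hm h1 hk
  have hQ : (1 : ℝ) < ((q : ℕ) : ℝ) := by exact_mod_cast hq
  have := Nat.lt_floor_add_one (Real.logb (q : ℕ) (1 / gamProd d m k))
  rw [Real.logb_lt_iff_lt_rpow hQ (by positivity)] at this
  rw [wPar, ← mul_assoc, ← div_lt_iff₀ hg, ← pow_succ']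
  exact_mod_cast this

theorem wPar_pos (hm : ∀ k ∈ Finset.Icc 1 d, 2 ≤ m k) {k : ℕ} (h1 : 1 ≤ k) (hk : k ≤ d) :
    0 < wPar d m q k :=
  mul_pos (pow_pos (by exact_mod_cast q.pos) _) (gamProd_pos hm h1 hk)

theorem pPar_anti (hm : ∀ k ∈ Finset.Icc 1 d, 2 ≤ m k) (hanti : AntitoneOn m (Set.Icc 1 d))
    (hq : 2 ≤ (q : ℕ)) {k l : ℕ} (h1 : 1 ≤ k) (hkl : k ≤ l) (hl : l ≤ d) :
    pPar d m q l ≤ pPar d m q k := by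
  have hQ : (1 : ℝ) < ((q : ℕ) : ℝ) := by exact_mod_cast hq
  have hg := gamProd_pos hm h1 (hkl.trans hl)
  have hg' := gamProd_pos hm (h1.trans hkl) hl
  exact Nat.floor_mono (Real.logb_le_logb_of_le hQ (by positivity)
    (one_div_le_one_div_of_le hg (gamProd_mono hm hanti h1 hkl hl)))

/-- The first sum of the formula thus covers the levels `p ≤ p_{d-1}`, where coordinate `d` alone is
read. -/
theorem jPar_eq (hd : 2 ≤ d) : jPar m q d = pPar d m q (d - 1) := by
  rw [jPar, pPar, gamProd, Nat.sub_add_cancel (by omega), Finset.Icc_self, Finset.prod_singleton]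

/-! ### Orderings -/

/-- Each ceiling costs at most `1`, which disappears after division by `n`. -/
theorem scaleComp_tendsto (hm : ∀ k ∈ Finset.Icc 1 d, 2 ≤ m k) {k : ℕ} (h1 : 1 ≤ k) (hk : k ≤ d) :
    Tendsto (fun n : ℕ => (scaleComp m k n : ℝ) / n) atTop
      (𝓝 (Real.log (m 1) / Real.log (m k))) := by
  induction k, h1 using Nat.le_induction with
  | base =>
    rw [div_self (log_digits_pos hm le_rfl hk).ne']
    refine tendsto_const_nhds.congr' ?_
    filter_upwards [eventually_gt_atTop 0] with n hn
    simp only [scaleComp, scaleMap, zero_add, if_true]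
    rw [div_self (by positivity)]
  | succ k h1 ih =>
    have hpos := log_digits_pos hm h1 (by omega : k ≤ d)
    have hpos' := log_digits_pos hm (by omega : 1 ≤ k + 1) hk
    have hg : gam m (k + 1) = Real.log (m (k + 1)) / Real.log (m k) := by simp [gam]
    have hg0 : 0 < gam m (k + 1) := hg ▸ div_pos hpos' hpos
    have hlim : Real.log (m 1) / Real.log (m (k + 1)) =
        Real.log (m 1) / Real.log (m k) / gam m (k + 1) := by
      rw [hg]; field_simp
    have h := (ih (by omega)).div_const (gam m (k + 1))
    have h' := h.add (tendsto_one_div_atTop_nhds_zero_nat (𝕜 := ℝ))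
    rw [add_zero] at h'
    rw [hlim]
    refine tendsto_of_tendsto_of_tendsto_of_le_of_le h h' (fun n => ?_) (fun n => ?_)
    · simp only [scaleComp, scaleMap, if_neg (by omega : ¬ k + 1 = 1)]
      rw [div_right_comm]
      gcongr
      exact Nat.le_ceil _
    · simp only [scaleComp, scaleMap, if_neg (by omega : ¬ k + 1 = 1)]
      rw [div_right_comm, ← add_div]
      gcongr
      exact (Nat.ceil_lt_add_one (by positivity)).le

/-- Without ceilings the two sides would be equal; each further `L_k` only rounds up. -/
theorem scaleComp_mul_log_le (hm : ∀ k ∈ Finset.Icc 1 d, 2 ≤ m k) {k l : ℕ} (h1 : 1 ≤ k)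
    (hkl : k ≤ l) (hl : l ≤ d) (n : ℕ) :
    (scaleComp m k n : ℝ) * Real.log (m k) ≤ scaleComp m l n * Real.log (m l) := by
  induction l, hkl using Nat.le_induction with
  | base => exact le_rfl
  | succ l hkl ih =>
    refine (ih (by omega)).trans ?_
    have hpos := log_digits_pos hm (h1.trans hkl) (by omega : l ≤ d)
    have hpos' := log_digits_pos hm (by omega : 1 ≤ l + 1) hl
    have hg : gam m (l + 1) = Real.log (m (l + 1)) / Real.log (m l) := by simp [gam]
    simp only [scaleComp, scaleMap, if_neg (by omega : ¬ l + 1 = 1)]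
    rw [← div_le_iff₀ hpos']
    refine le_trans (le_of_eq ?_) (Nat.le_ceil _)
    rw [hg]; field_simp

/-- Settles ties in the ordering: for equal `w`, the accumulated rounding favours the larger index
for every `n`. -/
theorem scaled_le_of_wPar_eq (hm : ∀ k ∈ Finset.Icc 1 d, 2 ≤ m k) {k l : ℕ} (h1 : 1 ≤ k)
    (hkl : k ≤ l) (hl : l ≤ d) (hw : wPar d m q k = wPar d m q l) (n : ℕ) :
    (scaleComp m k n : ℝ) * ((q : ℕ) : ℝ) ^ pPar d m q k ≤
      scaleComp m l n * ((q : ℕ) : ℝ) ^ pPar d m q l := by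
  have hk := hkl.trans hl
  have h1l := h1.trans hkl
  have hpd := log_digits_pos hm (h1.trans hk) le_rfl
  have hpk := log_digits_pos hm h1 hk
  have hpl := log_digits_pos hm h1l hl
  have hq0 : (0 : ℝ) < ((q : ℕ) : ℝ) := by exact_mod_cast q.pos
  rw [wPar, wPar, gamProd_eq hm h1 hk, gamProd_eq hm h1l hl] at hw
  have hqk : ((q : ℕ) : ℝ) ^ pPar d m q k =
      Real.log (m k) * (((q : ℕ) : ℝ) ^ pPar d m q l / Real.log (m l)) := by
    field_simp at hw ⊢
    linarith
  rw [hqk, ← mul_assoc]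
  refine (mul_le_mul_of_nonneg_right (scaleComp_mul_log_le hm h1 hkl hl n)
    (by positivity)).trans_eq ?_
  field_simp

theorem scaled_tendsto (hm : ∀ k ∈ Finset.Icc 1 d, 2 ≤ m k) {k : ℕ} (h1 : 1 ≤ k) (hk : k ≤ d) :
    Tendsto (fun n : ℕ => (scaleComp m k n : ℝ) * ((q : ℕ) : ℝ) ^ pPar d m q k / n) atTop
      (𝓝 (wPar d m q k * (Real.log (m 1) / Real.log (m d)))) := by
  have h := (scaleComp_tendsto hm h1 hk).mul_const (((q : ℕ) : ℝ) ^ pPar d m q k)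
  have hpd := log_digits_pos hm (h1.trans hk) le_rfl
  have hpk := log_digits_pos hm h1 hk
  convert h using 2
  · ring
  · rw [wPar, gamProd_eq hm h1 hk]
    field_simp

/-- Isolates a positive factor common to all terms of the sequence, so that the ordering condition
does not depend on `p`. -/
theorem div_zpow_eq (a Q : ℝ) (hQ : 0 < Q) (p P : ℕ) :
    a / Q ^ ((p : ℤ) - (P : ℤ) - 1) = a * Q ^ P * (Q / Q ^ p) := by
  rw [zpow_sub₀ hQ.ne', zpow_sub₀ hQ.ne', zpow_one, zpow_natCast, zpow_natCast]
  field_simp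

theorem IsOrdering.mem {s : ℕ} {τ : Equiv.Perm ℕ} (h : IsOrdering d m q s τ) {t : ℕ}
    (ht : t ∈ Finset.Icc s (d - 1)) : τ t ∈ Finset.Icc s (d - 1) := by
  by_contra hc
  have := τ.injective (h.fix _ hc)
  exact hc (this.symm ▸ ht)

/-- Divide the ordering condition by `n` and let `n → ∞`; this consequence is all that the dimension
formula needs from `σ_s`. -/
theorem IsOrdering.wPar_mono {s : ℕ} {τ : Equiv.Perm ℕ} (h : IsOrdering d m q s τ)
    (hm : ∀ k ∈ Finset.Icc 1 d, 2 ≤ m k) (hs : 1 ≤ s) :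
    MonotoneOn (fun t => wPar d m q (τ t)) (Set.Icc s (d - 1)) := by
  intro a ha b hb hab
  have hτa := Finset.mem_Icc.1 (h.mem (Finset.mem_Icc.2 ha))
  have hτb := Finset.mem_Icc.1 (h.mem (Finset.mem_Icc.2 hb))
  have hQ : (0 : ℝ) < ((q : ℕ) : ℝ) := by exact_mod_cast q.pos
  have hd : 1 ≤ d := by omega
  have hpos : 0 < Real.log (m 1) / Real.log (m d) :=
    div_pos (log_digits_pos hm le_rfl hd) (log_digits_pos hm hd le_rfl)
  refine le_of_mul_le_mul_right ?_ hpos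
  refine le_of_tendsto_of_tendsto (scaled_tendsto hm (by omega) (by omega))
    (scaled_tendsto hm (by omega) (by omega)) ?_
  filter_upwards [h.mono] with n hn
  have := hn 0 ha hb hab
  simp only [div_zpow_eq _ _ hQ] at this
  exact div_le_div_of_nonneg_right (le_of_mul_le_mul_right this (by positivity))
    (Nat.cast_nonneg n)

theorem exists_isOrdering (hm : ∀ k ∈ Finset.Icc 1 d, 2 ≤ m k) {s : ℕ}
    (hs : s ∈ Finset.Icc 1 (d - 1)) : ∃ τ, IsOrdering d m q s τ := by
  rw [Finset.mem_Icc] at hs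
  have hQ : (0 : ℝ) < ((q : ℕ) : ℝ) := by exact_mod_cast q.pos
  set e := Finset.orderIsoOfFin (Finset.Icc s (d - 1)) rfl with he
  -- Sorting by `w`, then by index: a strict inequality between the `w` persists for large `n`, and
  -- a tie is decided by the index.
  set key : Fin (Finset.Icc s (d - 1)).card → ℝ ×ₗ ℕ :=
    fun i => toLex (wPar d m q (e i), (e i : ℕ)) with hkey
  set τ : Equiv.Perm ℕ := (Tuple.sort key).extendDomain e.toEquiv with hτ
  have himg : ∀ i, τ (e i : ℕ) = e (Tuple.sort key i) := fun i =>
    Equiv.Perm.extendDomain_apply_image (Tuple.sort key) e.toEquiv i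
  refine ⟨τ, fun k hk => Equiv.Perm.extendDomain_apply_not_subtype _ _ hk, ?_⟩
  have hle : ∀ i j, key i ≤ key j → ∀ᶠ n : ℕ in atTop,
      (scaleComp m (e i) n : ℝ) * ((q : ℕ) : ℝ) ^ pPar d m q (e i) ≤
        scaleComp m (e j) n * ((q : ℕ) : ℝ) ^ pPar d m q (e j) := by
    intro i j hij
    have hi := Finset.mem_Icc.1 (e i).2
    have hj := Finset.mem_Icc.1 (e j).2
    rw [hkey, Prod.Lex.toLex_le_toLex] at hij
    rcases hij with hlt | ⟨heq, hij⟩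
    · have hd : 1 ≤ d := by omega
      have hpos : 0 < Real.log (m 1) / Real.log (m d) :=
        div_pos (log_digits_pos hm le_rfl hd) (log_digits_pos hm hd le_rfl)
      have := (scaled_tendsto (q := q) hm (by omega : 1 ≤ (e i : ℕ)) (by omega)).eventually_lt
        (scaled_tendsto hm (by omega : 1 ≤ (e j : ℕ)) (by omega)) (mul_lt_mul_of_pos_right hlt hpos)
      filter_upwards [this, eventually_gt_atTop 0] with n hn hn0
      exact ((div_lt_div_iff_of_pos_right (by exact_mod_cast hn0)).1 hn).le
    · exact Eventually.of_forall fun n =>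
        scaled_le_of_wPar_eq hm (by omega) hij (by omega) heq n
  have hall : ∀ᶠ n : ℕ in atTop, ∀ i j, key i ≤ key j →
      (scaleComp m (e i) n : ℝ) * ((q : ℕ) : ℝ) ^ pPar d m q (e i) ≤
        scaleComp m (e j) n * ((q : ℕ) : ℝ) ^ pPar d m q (e j) := by
    simp only [eventually_all]
    exact hle
  filter_upwards [hall] with n hn p a ha b hb hab
  obtain ⟨i, hi⟩ := e.surjective ⟨a, Finset.mem_Icc.2 ha⟩
  obtain ⟨j, hj⟩ := e.surjective ⟨b, Finset.mem_Icc.2 hb⟩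
  have hi' : a = (e i : ℕ) := by rw [hi]
  have hj' : b = (e j : ℕ) := by rw [hj]
  have hij : i ≤ j := by
    rw [← e.le_iff_le]
    exact Subtype.coe_le_coe.1 (by rwa [← hi', ← hj'])
  simp only [div_zpow_eq _ _ hQ]
  rw [hi', hj', himg, himg]
  exact mul_le_mul_of_nonneg_right (hn _ _ (Tuple.monotone_sort key hij)) (by positivity)

end MulSponge

/-! ### Covering numbers when closed balls are the fibres of a map -/

namespace Metric

variable {X Y : Type*} [PseudoMetricSpace X]

/-- One centre per fibre suffices, and every cover needs a centre in each fibre that meets `A`. -/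
theorem coveringNumber_eq_encard_image (A : Set X) (ε : ℝ≥0) (f : X → Y)
    (h : ∀ x y, dist x y ≤ ε ↔ f x = f y) : coveringNumber ε A = (f '' A).encard := by
  apply le_antisymm
  · obtain ⟨C, hCA, hC⟩ := A.exists_subset_bijOn f
    rw [← hC.image_eq, hC.injOn.encard_image]
    refine IsCover.coveringNumber_le_encard hCA ?_
    rw [isCover_iff_subset_iUnion_closedBall]
    intro x hx
    obtain ⟨y, hy, hyx⟩ := hC.surjOn (Set.mem_image_of_mem f hx)
    exact Set.mem_iUnion₂.2 ⟨y, hy, (h x y).2 hyx.symm⟩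
  · simp only [coveringNumber, le_iInf_iff]
    intro C _ hC
    rw [isCover_iff_subset_iUnion_closedBall] at hC
    refine le_trans (Set.encard_le_encard ?_) (Set.encard_image_le f C)
    rintro _ ⟨x, hx, rfl⟩
    obtain ⟨y, hy, hyx⟩ := Set.mem_iUnion₂.1 (hC hx)
    exact ⟨y, hy, ((h x y).1 hyx).symm⟩

theorem totallyBounded_of_coveringNumber_ne_top {A : Set X}
    (h : ∀ ε : ℝ≥0, 0 < ε → coveringNumber ε A ≠ ⊤) : TotallyBounded A := by
  rw [totallyBounded_iff]
  intro ε hε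
  set δ : ℝ≥0 := ⟨ε / 2, by positivity⟩ with hδ
  have hδ0 : 0 < δ := by
    rw [← NNReal.coe_pos]; exact half_pos hε
  have hne := h δ hδ0
  have : ∃ C : Set X, IsCover δ A C ∧ C.Finite := by
    by_contra! hc
    refine hne ?_
    simp only [coveringNumber, iInf_eq_top]
    exact fun C _ hC => Set.encard_eq_top (hc C hC)
  obtain ⟨C, hC, hfin⟩ := this
  rw [isCover_iff_subset_iUnion_closedBall] at hC
  refine ⟨C, hfin, hC.trans (Set.iUnion₂_mono fun y _ => closedBall_subset_ball ?_)⟩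
  exact half_lt_self hε

end Metric

namespace MulSponge

variable {d : ℕ} {m : ℕ → ℕ} {q : ℕ+}

/-! ### Closed balls -/

theorem coordDist_le_iff (hm : ∀ k ∈ Finset.Icc 1 d, 2 ≤ m k) (x y : DigitSeq d m)
    (k : Finset.Icc 1 d) {ε : ℝ} (hε : 0 < ε) :
    coordDist x y k ≤ ε ↔
      ∀ i : ℕ+, (i : ℕ) ≤ ⌈Real.log (1 / ε) / Real.log (m k)⌉₊ → x i k = y i k := by
  by_cases hxy : ∀ i, x i k = y i k
  · rw [coordDist, if_pos hxy]
    exact ⟨fun _ i _ => hxy i, fun _ => hε.le⟩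
  have hne : {i : ℕ | x i.succPNat k ≠ y i.succPNat k}.Nonempty := by
    push Not at hxy
    obtain ⟨i, hi⟩ := hxy
    exact ⟨i.natPred, by simpa using hi⟩
  have hmem := Nat.sInf_mem hne
  rw [coordDist, if_neg hxy]
  set N := sInf {i : ℕ | x i.succPNat k ≠ y i.succPNat k} with hN
  have hm2 : (2 : ℝ) ≤ m k := by exact_mod_cast hm k k.2
  have hlog : 0 < Real.log (m k) := Real.log_pos (by linarith)
  have h1 : ((m k : ℝ)⁻¹) ^ N ≤ ε ↔ ⌈Real.log (1 / ε) / Real.log (m k)⌉₊ ≤ N := by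
    rw [Nat.ceil_le, div_le_iff₀ hlog, ← Real.log_pow,
      Real.log_le_log_iff (by positivity) (by positivity), inv_pow, one_div]
    exact inv_le_comm₀ (by positivity) hε
  rw [h1]
  constructor
  · intro h i hi
    by_contra hc
    have : N ≤ i.natPred := Nat.sInf_le (by simpa using hc)
    have := PNat.natPred_add_one i
    omega
  · intro h
    by_contra! hc
    exact hmem (h N.succPNat (by simpa using hc))

theorem dist_le_iff (hm : ∀ k ∈ Finset.Icc 1 d, 2 ≤ m k) (x y : DigitSeq d m)
    {ε : ℝ} (hε : 0 < ε) :
    dist x y ≤ ε ↔ ∀ (i : ℕ+) (k : Finset.Icc 1 d),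
      (i : ℕ) ≤ ⌈Real.log (1 / ε) / Real.log (m k)⌉₊ → x i k = y i k := by
  have hb : BddAbove (Set.range (coordDist x y)) := (Set.finite_range _).bddAbove
  have : dist x y ≤ ε ↔ ∀ k, coordDist x y k ≤ ε :=
    ⟨fun h k => (le_ciSup hb k).trans h, fun h => Real.iSup_le h hε.le⟩
  rw [this, forall_comm]
  exact forall_congr' fun k => coordDist_le_iff hm x y k hε

/-! ### Restrictions to sets of places -/

/-- The restriction of a point to a set of places. -/
def restr (P : Set (ℕ+ × Finset.Icc 1 d)) (x : DigitSeq d m) : (c : P) → Fin (m c.1.2) :=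
  fun c => x c.1.1 c.1.2

/-- The number of restrictions of points of `Ω` to the set `P` of places. -/
noncomputable def numRestr (Ω : Set (DigitSeq d m)) (P : Set (ℕ+ × Finset.Icc 1 d)) : ℕ :=
  (restr P '' Ω).ncard

/-- The places of the subsequence `(x_{i q^ℓ})_ℓ` that are read when coordinate `k` of `x` is read
at the positions up to `N k`. -/
def subPlaces (q : ℕ+) (N : Finset.Icc 1 d → ℕ) (i : ℕ) : Set (ℕ+ × Finset.Icc 1 d) :=
  {c | i * (q : ℕ) ^ c.1.natPred ≤ N c.2}

/-- The subsequence `(x_{i q^ℓ})_ℓ`. -/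
def subSeq (q i : ℕ+) (x : DigitSeq d m) : DigitSeq d m := fun n => x (i * q ^ n.natPred)

theorem finite_of_forall_le {P : Set (ℕ+ × Finset.Icc 1 d)} {L : ℕ}
    (hP : ∀ c ∈ P, (c.1 : ℕ) ≤ L) : P.Finite ∧ P.ncard ≤ L * d := by
  have hinj : Function.Injective
      (fun c : P => ((⟨c.1.1.natPred, by
        have := hP _ c.2; have := PNat.natPred_add_one c.1.1; omega⟩, c.1.2) :
          Fin L × Finset.Icc 1 d)) := by
    rintro ⟨⟨a, k⟩, ha⟩ ⟨⟨b, l⟩, hb⟩ h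
    simp only [Prod.mk.injEq, Fin.mk.injEq] at h
    have hab : a = b := PNat.natPred_injective h.1
    simp [hab, h.2]
  have hfin : Finite P := Finite.of_injective _ hinj
  refine ⟨hfin, ?_⟩
  have := Nat.card_le_card_of_injective _ hinj
  rwa [Nat.card_coe_set_eq, Nat.card_prod, Nat.card_fin, Nat.card_eq_fintype_card,
    Fintype.card_coe, Nat.card_Icc, Nat.add_sub_cancel] at this

theorem numRestr_le (hd : 1 ≤ d) (hm : ∀ k ∈ Finset.Icc 1 d, 2 ≤ m k) (hanti : AntitoneOn m (Set.Icc 1 d))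
    (Ω : Set (DigitSeq d m)) {P : Set (ℕ+ × Finset.Icc 1 d)} {L : ℕ}
    (hP : ∀ c ∈ P, (c.1 : ℕ) ≤ L) : numRestr Ω P ≤ m 1 ^ (L * d) := by
  obtain ⟨hfin, hcard⟩ := finite_of_forall_le hP
  have : Fintype P := hfin.fintype
  have hm1 := hm 1 (Finset.mem_Icc.2 ⟨le_rfl, hd⟩)
  calc numRestr Ω P ≤ Nat.card ((c : P) → Fin (m c.1.2)) := Set.ncard_le_card _
    _ = ∏ c : P, m c.1.2 := by simp [Nat.card_eq_fintype_card]
    _ ≤ ∏ _c : P, m 1 := by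
        refine Finset.prod_le_prod' fun c _ => ?_
        have := Finset.mem_Icc.1 c.1.2.2
        exact hanti ⟨le_rfl, hd⟩ this this.1
    _ = m 1 ^ P.ncard := by
        rw [Finset.prod_const, Finset.card_univ, ← Nat.card_eq_fintype_card, Nat.card_coe_set_eq]
    _ ≤ m 1 ^ (L * d) := Nat.pow_le_pow_right (by omega) hcard

theorem numRestr_pos {Ω : Set (DigitSeq d m)} (hne : Ω.Nonempty) {P : Set (ℕ+ × Finset.Icc 1 d)}
    (hP : P.Finite) : 0 < numRestr Ω P := by
  have : Finite P := hP
  exact (Set.ncard_pos).2 (hne.image _)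

/-- A crude bound from `r < q ^ r`, used only for finiteness. -/
theorem le_of_mem_subPlaces (hq : 2 ≤ (q : ℕ)) {N : Finset.Icc 1 d → ℕ} {M : ℕ}
    (hN : ∀ k, N k ≤ M) {i : ℕ} (hi : 1 ≤ i) : ∀ c ∈ subPlaces q N i, (c.1 : ℕ) ≤ M := by
  intro c hc
  have h1 : c.1.natPred < (q : ℕ) ^ c.1.natPred := Nat.lt_pow_self (by omega)
  have h2 : (q : ℕ) ^ c.1.natPred ≤ i * (q : ℕ) ^ c.1.natPred := Nat.le_mul_of_pos_left _ hi
  have h3 : i * (q : ℕ) ^ c.1.natPred ≤ N c.2 := hc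
  have := PNat.natPred_add_one c.1
  have := hN c.2
  omega

/-! ### Factorisation of `X_Ω` along geometric progressions -/

/-- The integers in `[1, M]` that are not divisible by `q`. -/
def gens (q : ℕ+) (M : ℕ) : Finset ℕ := (Finset.Icc 1 M).filter fun i => ¬ (q : ℕ) ∣ i

/-- The restrictions of the subsequences `(x_{i q^ℓ})_ℓ` to their places. -/
def multiRestr (q : ℕ+) (N : Finset.Icc 1 d → ℕ) (M : ℕ) (x : DigitSeq d m) :
    (i : gens q M) → (c : subPlaces q N i) → Fin (m c.1.2) :=
  fun i => restr (subPlaces q N i) (subSeq q (Nat.toPNat' i) x)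

theorem coe_toPNat_of_mem_gens {M : ℕ} (i : gens q M) : ((Nat.toPNat' i : ℕ+) : ℕ) = i := by
  have := Finset.mem_Icc.1 (Finset.mem_filter.1 i.2).1
  rw [Nat.toPNat'_coe, if_pos (by omega)]

theorem exists_eq_mul_pow (hq : 2 ≤ (q : ℕ)) (n : ℕ+) :
    ∃ (i : ℕ+) (e : ℕ), ¬ (q : ℕ) ∣ i ∧ n = i * q ^ e := by
  obtain ⟨e, i, hi, hn⟩ := Nat.exists_eq_pow_mul_and_not_dvd n.ne_zero (q : ℕ) (by omega)
  have hi0 : 0 < i := Nat.pos_of_ne_zero fun h => hi (h ▸ dvd_zero _)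
  obtain ⟨j, rfl⟩ : ∃ j : ℕ+, (j : ℕ) = i := ⟨⟨i, hi0⟩, rfl⟩
  exact ⟨j, e, hi, PNat.coe_injective (by rw [PNat.mul_coe, PNat.pow_coe, hn, mul_comm])⟩

theorem eq_of_mul_pow_eq {i j : ℕ+} {e f : ℕ} (hi : ¬ (q : ℕ) ∣ i) (hj : ¬ (q : ℕ) ∣ j)
    (h : i * q ^ e = j * q ^ f) : i = j ∧ e = f := by
  wlog hef : e ≤ f generalizing i j e f
  · obtain ⟨h1, h2⟩ := this hj hi h.symm (by omega)
    exact ⟨h1.symm, h2.symm⟩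
  obtain ⟨r, rfl⟩ := Nat.exists_eq_add_of_le hef
  have h' : i = j * q ^ r := by
    rw [pow_add, mul_left_comm, mul_comm i] at h
    exact mul_left_cancel h
  rcases Nat.eq_zero_or_pos r with rfl | hr
  · simpa using h'
  · refine absurd ?_ hi
    rw [h', PNat.mul_coe, PNat.pow_coe]
    exact dvd_mul_of_dvd_right (dvd_pow_self _ hr.ne') _

/-- Reading all progressions amounts to reading all positions, as each position is some `i * q ^ e`
with `q ∤ i`. -/
theorem multiRestr_eq_iff (hq : 2 ≤ (q : ℕ)) {N : Finset.Icc 1 d → ℕ} {M : ℕ} (hN : ∀ k, N k ≤ M)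
    (x y : DigitSeq d m) : multiRestr q N M x = multiRestr q N M y ↔
      ∀ (i : ℕ+) (k : Finset.Icc 1 d), (i : ℕ) ≤ N k → x i k = y i k := by
  constructor
  · intro h n k hn
    obtain ⟨i, e, hi, rfl⟩ := exists_eq_mul_pow hq n
    have hle : (i : ℕ) * (q : ℕ) ^ e ≤ N k := by simpa using hn
    have hiM : (i : ℕ) ≤ M :=
      (Nat.le_mul_of_pos_right _ (pow_pos q.pos e)).trans (hle.trans (hN k))
    have himem : (i : ℕ) ∈ gens q M :=
      Finset.mem_filter.2 ⟨Finset.mem_Icc.2 ⟨i.pos, hiM⟩, hi⟩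
    have := congrFun (congrFun h ⟨i, himem⟩) ⟨(e.succPNat, k), by simpa [subPlaces] using hle⟩
    simpa [multiRestr, restr, subSeq] using this
  · intro h
    funext i c
    refine h _ _ ?_
    have := c.2
    rw [PNat.mul_coe, PNat.pow_coe, coe_toPNat_of_mem_gens]
    exact this

/-- The progressions are disjoint, so points of `Ω` can be prescribed independently along them. -/
theorem multiRestr_image (hq : 2 ≤ (q : ℕ)) {Ω : Set (DigitSeq d m)} (hne : Ω.Nonempty)
    (N : Finset.Icc 1 d → ℕ) (M : ℕ) :
    multiRestr q N M '' mulSet q Ω =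
      Set.pi Set.univ fun i : gens q M => restr (subPlaces q N i) '' Ω := by
  ext z
  constructor
  · rintro ⟨x, hx, rfl⟩ i -
    refine ⟨_, hx (Nat.toPNat' i) ?_, rfl⟩
    rw [coe_toPNat_of_mem_gens]
    exact (Finset.mem_filter.1 i.2).2
  · intro hz
    choose ω hω hωz using fun i => hz i (Set.mem_univ i)
    obtain ⟨ω₀, hω₀⟩ := hne
    choose a e ha hae using exists_eq_mul_pow (q := q) hq
    have hdec : ∀ (i : ℕ+) (r : ℕ), ¬ (q : ℕ) ∣ i → a (i * q ^ r) = i ∧ e (i * q ^ r) = r :=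
      fun i r hi => eq_of_mul_pow_eq (ha _) hi (hae (i * q ^ r)).symm
    -- The progression of `i` carries the chosen point `ω i`; generators beyond `M` carry the fixed
    -- point `ω₀`, so that `x` lies in `X_Ω`.
    set x : DigitSeq d m := fun n =>
      if h : (a n : ℕ) ∈ gens q M then ω ⟨a n, h⟩ (e n).succPNat else ω₀ (e n).succPNat with hx
    have hsub : ∀ (i : ℕ+) (hi : ¬ (q : ℕ) ∣ i), subSeq q i x =
        if h : (i : ℕ) ∈ gens q M then ω ⟨i, h⟩ else ω₀ := by
      intro i hi
      funext n
      obtain ⟨h1, h2⟩ := hdec i n.natPred hi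
      simp only [subSeq, hx, h1, h2, PNat.succPNat_natPred]
      split_ifs <;> rfl
    refine ⟨x, fun i hi => ?_, ?_⟩
    · change subSeq q i x ∈ Ω
      rw [hsub i hi]
      split_ifs with h
      · exact hω _
      · exact hω₀
    · funext i
      rw [← hωz i, multiRestr, hsub _ (by
        rw [coe_toPNat_of_mem_gens]; exact (Finset.mem_filter.1 i.2).2), dif_pos (by
        rw [coe_toPNat_of_mem_gens]; exact i.2)]
      congr 3
      exact coe_toPNat_of_mem_gens i

theorem encard_multiRestr_image (hq : 2 ≤ (q : ℕ)) {Ω : Set (DigitSeq d m)} (hne : Ω.Nonempty)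
    {N : Finset.Icc 1 d → ℕ} {M : ℕ} (hN : ∀ k, N k ≤ M) :
    (multiRestr q N M '' mulSet q Ω).encard =
      ((∏ i ∈ gens q M, numRestr Ω (subPlaces q N i) : ℕ) : ℕ∞) := by
  rw [multiRestr_image hq hne, Set.encard_pi_eq_prod_encard,
    ← Finset.prod_coe_sort (gens q M) fun i => numRestr Ω (subPlaces q N i), Nat.cast_prod]
  refine Finset.prod_congr rfl fun i _ => ?_
  have : Finite (subPlaces q N i) :=
    (finite_of_forall_le (le_of_mem_subPlaces hq hN
      (Finset.mem_Icc.1 (Finset.mem_filter.1 i.2).1).1)).1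
  rw [numRestr, Set.Finite.cast_ncard_eq (Set.toFinite _)]

/-- The number of digits of coordinate `k` that closed balls of radius `m_d ^ (-T)` fix. -/
noncomputable def radii (d : ℕ) (m : ℕ → ℕ) (T : ℝ) (k : Finset.Icc 1 d) : ℕ :=
  ⌈gamProd d m k * T⌉₊

theorem radii_le (hm : ∀ k ∈ Finset.Icc 1 d, 2 ≤ m k) (hanti : AntitoneOn m (Set.Icc 1 d))
    {T : ℝ} (hT : 0 ≤ T) (k : Finset.Icc 1 d) : radii d m T k ≤ ⌊T⌋₊ + 1 := by
  have hk := Finset.mem_Icc.1 k.2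
  refine (Nat.ceil_mono ?_).trans (Nat.ceil_le_floor_add_one T)
  exact mul_le_of_le_one_left hT (gamProd_le_one hm hanti hk.1 hk.2)

theorem coveringNumber_mulSet (hd : 1 ≤ d) (hm : ∀ k ∈ Finset.Icc 1 d, 2 ≤ m k)
    (hq : 2 ≤ (q : ℕ)) {Ω : Set (DigitSeq d m)} (hne : Ω.Nonempty)
    {ε : ℝ≥0} (hε : 0 < ε) {M : ℕ}
    (hM : ∀ k, radii d m (Real.log (1 / (ε : ℝ)) / Real.log (m d)) k ≤ M) :
    Metric.coveringNumber ε (mulSet q Ω) = ((∏ i ∈ gens q M, numRestr Ω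
      (subPlaces q (radii d m (Real.log (1 / (ε : ℝ)) / Real.log (m d))) i) : ℕ) : ℕ∞) := by
  rw [← encard_multiRestr_image hq hne hM]
  refine Metric.coveringNumber_eq_encard_image _ _ _ fun x y => ?_
  rw [multiRestr_eq_iff hq hM, dist_le_iff hm x y (NNReal.coe_pos.2 hε)]
  have hr : ∀ k : Finset.Icc 1 d, radii d m (Real.log (1 / (ε : ℝ)) / Real.log (m d)) k =
      ⌈Real.log (1 / (ε : ℝ)) / Real.log (m k)⌉₊ := by
    intro k
    have hk := Finset.mem_Icc.1 k.2
    have := log_digits_pos hm hd le_rfl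
    have := log_digits_pos hm hk.1 hk.2
    rw [radii, gamProd_eq hm hk.1 hk.2]
    congr 1
    field_simp
  simp only [hr]

end MulSponge

namespace MulSponge

variable {d : ℕ} {m : ℕ → ℕ} {q : ℕ+}

/-! ### Sums over the integers that are not divisible by `q` -/

/-- The logarithm of the number of restrictions of `Ω` to the places of `(x_{i q^ℓ})_ℓ` that closed
balls of radius `m_d ^ (-T)` fix, if `q ∤ i`. -/
noncomputable def weight (q : ℕ+) (Ω : Set (DigitSeq d m)) (T : ℝ) (i : ℕ) : ℝ :=
  if (q : ℕ) ∣ i then 0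
  else Real.logb (m d) (numRestr Ω (subPlaces q (radii d m T) i))

/-- The places fixed, in the limit, for `i = b T`. -/
def limPlaces (d : ℕ) (m : ℕ → ℕ) (q : ℕ+) (b : ℝ) : Set (ℕ+ × Finset.Icc 1 d) :=
  {c | b * ((q : ℕ) : ℝ) ^ c.1.natPred ≤ gamProd d m c.2}

theorem tendsto_sum_Ioc_zero_indicator (q : ℕ+) {b : ℝ} (hb : 0 ≤ b) :
    Tendsto (fun T : ℝ => (∑ i ∈ Finset.Ioc 0 ⌊b * T⌋₊, if (q : ℕ) ∣ i then (0 : ℝ) else 1) / T)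
      atTop (𝓝 (b * (1 - 1 / ((q : ℕ) : ℝ)))) := by
  have h1 := (tendsto_nat_floor_mul_div_atTop (R := ℝ) hb).sub
    (tendsto_nat_floor_mul_div_atTop (R := ℝ) (a := b / ((q : ℕ) : ℝ)) (by positivity))
  convert h1 using 2 with T
  · have : ⌊b / ((q : ℕ) : ℝ) * T⌋₊ = ⌊b * T⌋₊ / (q : ℕ) := by
      rw [div_mul_eq_mul_div, Nat.floor_div_natCast]
    -- The non-multiples are counted as all integers up to `⌊b * T⌋₊` minus the multiples of `q`.
    rw [this, ← Nat.Ioc_filter_dvd_card_eq_div, ← sub_div, Finset.card_filter, Nat.cast_sum]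
    congr 1
    have : ((⌊b * T⌋₊ : ℕ) : ℝ) = ∑ i ∈ Finset.Ioc 0 ⌊b * T⌋₊, (1 : ℝ) := by simp
    rw [this, ← Finset.sum_sub_distrib]
    refine Finset.sum_congr rfl fun i _ => ?_
    split_ifs <;> simp
  · ring

theorem tendsto_sum_Ioc_indicator (q : ℕ+) {a b : ℝ} (ha : 0 ≤ a) (hab : a ≤ b) :
    Tendsto (fun T : ℝ =>
        (∑ i ∈ Finset.Ioc ⌊a * T⌋₊ ⌊b * T⌋₊, if (q : ℕ) ∣ i then (0 : ℝ) else 1) / T)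
      atTop (𝓝 ((b - a) * (1 - 1 / ((q : ℕ) : ℝ)))) := by
  have h := (tendsto_sum_Ioc_zero_indicator q (ha.trans hab)).sub
    (tendsto_sum_Ioc_zero_indicator q ha)
  rw [← sub_mul] at h
  refine h.congr' ?_
  filter_upwards [eventually_ge_atTop 0] with T hT
  rw [← sub_div, ← Finset.sum_Ioc_consecutive _ (Nat.zero_le ⌊a * T⌋₊)
    (Nat.floor_mono (mul_le_mul_of_nonneg_right hab hT)), add_sub_cancel_left]

/-- The margin `1` in `a * T + 1 ≤ i` absorbs the ceiling in `radii`: if `g ≤ a q^e`, then `⌈g T⌉ <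
g T + 1 ≤ (a T + 1) q^e ≤ i q^e`. -/
theorem subPlaces_eq_limPlaces (hm : ∀ k ∈ Finset.Icc 1 d, 2 ≤ m k) {a b T : ℝ}
    (hab : a < b) (hT : 0 ≤ T)
    (hcell : ∀ (e : ℕ) (k : ℕ), 1 ≤ k → k ≤ d →
      b * ((q : ℕ) : ℝ) ^ e ≤ gamProd d m k ∨ gamProd d m k ≤ a * ((q : ℕ) : ℝ) ^ e)
    {i : ℕ} (hai : a * T + 1 ≤ i) (hib : i ≤ b * T) :
    subPlaces q (radii d m T) i = limPlaces d m q b := by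
  ext ⟨n, k⟩
  have hk := Finset.mem_Icc.1 k.2
  have hQ : (1 : ℝ) ≤ ((q : ℕ) : ℝ) := by exact_mod_cast q.pos
  have hQe : (1 : ℝ) ≤ ((q : ℕ) : ℝ) ^ n.natPred := one_le_pow₀ hQ
  have hg := gamProd_pos hm hk.1 hk.2
  simp only [subPlaces, limPlaces, radii, Set.mem_ofPred_eq]
  rcases hcell n.natPred k hk.1 hk.2 with h | h
  · simp only [h, iff_true]
    have : ((i * (q : ℕ) ^ n.natPred : ℕ) : ℝ) ≤ (⌈gamProd d m k * T⌉₊ : ℕ) := by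
      push_cast
      calc (i : ℝ) * ((q : ℕ) : ℝ) ^ n.natPred ≤ b * T * ((q : ℕ) : ℝ) ^ n.natPred := by gcongr
        _ = b * ((q : ℕ) : ℝ) ^ n.natPred * T := by ring
        _ ≤ gamProd d m k * T := by gcongr
        _ ≤ _ := Nat.le_ceil _
    exact_mod_cast this
  · have h1 : ¬ b * ((q : ℕ) : ℝ) ^ n.natPred ≤ gamProd d m k := by
      rw [not_le]
      exact h.trans_lt (by gcongr)
    simp only [h1, iff_false, not_le]
    have : ((⌈gamProd d m k * T⌉₊ : ℕ) : ℝ) < ((i * (q : ℕ) ^ n.natPred : ℕ) : ℝ) := by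
      push_cast
      calc ((⌈gamProd d m k * T⌉₊ : ℕ) : ℝ) < gamProd d m k * T + 1 :=
            Nat.ceil_lt_add_one (by positivity)
        _ ≤ a * ((q : ℕ) : ℝ) ^ n.natPred * T + ((q : ℕ) : ℝ) ^ n.natPred := by gcongr
        _ = (a * T + 1) * ((q : ℕ) : ℝ) ^ n.natPred := by ring
        _ ≤ _ := by gcongr
    exact_mod_cast this

/-- A bound for the weights of the integers `i > q ^ (-p) T`. -/
noncomputable def weightBound (d : ℕ) (m : ℕ → ℕ) (p : ℕ) : ℝ :=
  (((p + 1) * d : ℕ) : ℝ) * Real.logb (m d) (m 1)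

theorem one_lt_last (hd : 1 ≤ d) (hm : ∀ k ∈ Finset.Icc 1 d, 2 ≤ m k) : (1 : ℝ) < m d := by
  exact_mod_cast hm d (Finset.mem_Icc.2 ⟨hd, le_rfl⟩)

theorem weightBound_nonneg (hd : 1 ≤ d) (hm : ∀ k ∈ Finset.Icc 1 d, 2 ≤ m k) (p : ℕ) :
    0 ≤ weightBound d m p := by
  have h1 : (1 : ℝ) ≤ m 1 := by
    have := hm 1 (Finset.mem_Icc.2 ⟨le_rfl, hd⟩)
    exact_mod_cast (by omega : 1 ≤ m 1)
  exact mul_nonneg (Nat.cast_nonneg _) (Real.logb_nonneg (one_lt_last hd hm) h1)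

theorem weight_mem (hd : 1 ≤ d) (hm : ∀ k ∈ Finset.Icc 1 d, 2 ≤ m k)
    (hanti : AntitoneOn m (Set.Icc 1 d)) (hq : 2 ≤ (q : ℕ)) {Ω : Set (DigitSeq d m)}
    (hne : Ω.Nonempty) {T : ℝ} (hT : 1 ≤ T) {p i : ℕ} (hi : (((q : ℕ) : ℝ) ^ p)⁻¹ * T < i) :
    0 ≤ weight q Ω T i ∧ weight q Ω T i ≤ weightBound d m p := by
  have hQ : (2 : ℝ) ≤ ((q : ℕ) : ℝ) := by exact_mod_cast hq
  have hQp : (0 : ℝ) < ((q : ℕ) : ℝ) ^ p := by positivity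
  rw [weight]
  split_ifs with hdvd
  · exact ⟨le_rfl, weightBound_nonneg hd hm p⟩
  have hP : ∀ c ∈ subPlaces (d := d) q (radii d m T) i, (c.1 : ℕ) ≤ p + 1 := by
    intro c hc
    have h1 : (i : ℝ) * ((q : ℕ) : ℝ) ^ c.1.natPred ≤ T + 1 := by
      have h2 : i * (q : ℕ) ^ c.1.natPred ≤ ⌊T⌋₊ + 1 :=
        le_trans hc (radii_le hm hanti (by linarith) c.2)
      have h3 : ((i * (q : ℕ) ^ c.1.natPred : ℕ) : ℝ) ≤ ((⌊T⌋₊ + 1 : ℕ) : ℝ) := by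
        exact_mod_cast h2
      push_cast at h3
      linarith [Nat.floor_le (by linarith : 0 ≤ T)]
    -- With `e = c.1.natPred`, `i q^e ≤ T + 1 ≤ 2T` and `i > q^(-p) T` give `q^e < 2 q^p ≤ q^(p+1)`.
    have h4 : ((q : ℕ) : ℝ) ^ c.1.natPred < ((q : ℕ) : ℝ) ^ (p + 1) := by
      have h5 : (((q : ℕ) : ℝ) ^ p)⁻¹ * T * ((q : ℕ) : ℝ) ^ c.1.natPred < 2 * T :=
        (mul_lt_mul_of_pos_right hi (by positivity)).trans_le (by linarith)
      have h6 : (((q : ℕ) : ℝ) ^ p)⁻¹ * ((q : ℕ) : ℝ) ^ c.1.natPred < 2 := by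
        refine lt_of_mul_lt_mul_right (a := T) ?_ (by linarith)
        linarith
      rw [inv_mul_lt_iff₀ hQp] at h6
      rw [pow_succ]
      exact h6.trans_le (by gcongr)
    have := (pow_lt_pow_iff_right₀ (by linarith : (1 : ℝ) < ((q : ℕ) : ℝ))).1 h4
    have := PNat.natPred_add_one c.1
    omega
  have hpos := numRestr_pos hne (finite_of_forall_le hP).1
  have hle := numRestr_le hd hm hanti Ω hP
  have h1 := one_lt_last hd hm
  refine ⟨Real.logb_nonneg h1 (by exact_mod_cast hpos), ?_⟩
  rw [weightBound, ← Real.logb_pow]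
  exact Real.logb_le_logb_of_le h1 (by exact_mod_cast hpos) (by exact_mod_cast hle)

theorem tendsto_cell (hd : 1 ≤ d) (hm : ∀ k ∈ Finset.Icc 1 d, 2 ≤ m k)
    (hanti : AntitoneOn m (Set.Icc 1 d)) (hq : 2 ≤ (q : ℕ)) {Ω : Set (DigitSeq d m)}
    (hne : Ω.Nonempty) {a b : ℝ} {p : ℕ} (hpa : (((q : ℕ) : ℝ) ^ p)⁻¹ ≤ a) (hab : a < b)
    (hcell : ∀ (e : ℕ) (k : ℕ), 1 ≤ k → k ≤ d →
      b * ((q : ℕ) : ℝ) ^ e ≤ gamProd d m k ∨ gamProd d m k ≤ a * ((q : ℕ) : ℝ) ^ e) :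
    Tendsto (fun T : ℝ => (∑ i ∈ Finset.Ioc ⌊a * T⌋₊ ⌊b * T⌋₊, weight q Ω T i) / T) atTop
      (𝓝 ((b - a) * (1 - 1 / ((q : ℕ) : ℝ)) *
        Real.logb (m d) (numRestr Ω (limPlaces d m q b)))) := by
  set C := Real.logb (m d) (numRestr Ω (limPlaces d m q b)) with hC
  have ha : 0 ≤ a := le_trans (by positivity) hpa
  set r : ℝ → ℝ := fun T => ∑ i ∈ Finset.Ioc ⌊a * T⌋₊ ⌊b * T⌋₊,
    (weight q Ω T i - (if (q : ℕ) ∣ i then (0 : ℝ) else 1) * C) with hr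
  have hrlim : Tendsto (fun T => r T / T) atTop (𝓝 0) := by
    refine squeeze_zero_norm' (a := fun T => (weightBound d m p + |C|) / T) ?_
      (tendsto_const_nhds.div_atTop tendsto_id)
    filter_upwards [eventually_ge_atTop 1] with T hT
    rw [norm_div, Real.norm_of_nonneg (by linarith : 0 ≤ T)]
    refine div_le_div_of_nonneg_right ?_ (by linarith)
    have hB := weightBound_nonneg (p := p) hd hm
    -- Only the first integer of the cell can have a pattern other than the limiting one; its error
    -- is bounded, hence `o(T)`.
    by_cases hmem : ⌊a * T⌋₊ + 1 ∈ Finset.Ioc ⌊a * T⌋₊ ⌊b * T⌋₊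
    · rw [hr]
      dsimp only
      rw [Finset.sum_eq_single_of_mem _ hmem]
      · have hlt : a * T < (⌊a * T⌋₊ + 1 : ℕ) := by
          push_cast; exact Nat.lt_floor_add_one _
        obtain ⟨h0, h1⟩ := weight_mem (p := p) hd hm hanti hq hne hT
          ((mul_le_mul_of_nonneg_right hpa (by linarith)).trans_lt hlt)
        rw [Real.norm_eq_abs]
        refine (abs_sub _ _).trans (add_le_add (by rwa [abs_of_nonneg h0]) ?_)
        split_ifs <;> simp
      · intro i hi hine
        rw [Finset.mem_Ioc] at hi
        rw [weight]
        split_ifs with hdvd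
        · simp
        · rw [subPlaces_eq_limPlaces hm hab (by linarith) hcell, ← hC, one_mul, sub_self]
          · have h2 : ⌊a * T⌋₊ + 2 ≤ i := by omega
            have h3 : ((⌊a * T⌋₊ + 2 : ℕ) : ℝ) ≤ i := by exact_mod_cast h2
            push_cast at h3
            linarith [Nat.lt_floor_add_one (a * T)]
          · exact (Nat.cast_le.2 hi.2).trans
              (Nat.floor_le (mul_nonneg (ha.trans hab.le) (by linarith)))
    · have : Finset.Ioc ⌊a * T⌋₊ ⌊b * T⌋₊ = ∅ := by
        rw [Finset.mem_Ioc] at hmem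
        exact Finset.Ioc_eq_empty_of_le (by omega)
      rw [hr]
      dsimp only
      rw [this, Finset.sum_empty, norm_zero]
      positivity
  have h := ((tendsto_sum_Ioc_indicator q ha hab.le).mul_const C).add hrlim
  rw [add_zero] at h
  refine h.congr fun T => ?_
  rw [hr]
  dsimp only
  rw [Finset.sum_sub_distrib, ← Finset.sum_mul]
  ring

/-! ### Summation over the levels -/

/-- The contribution of the integers `i` in `(q ^ (-(p + 1)) T, q ^ (-p) T]`. -/
noncomputable def levelMean (q : ℕ+) (Ω : Set (DigitSeq d m)) (T : ℝ) (p : ℕ) : ℝ :=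
  (∑ i ∈ Finset.Ioc ⌊(((q : ℕ) : ℝ) ^ (p + 1))⁻¹ * T⌋₊ ⌊(((q : ℕ) : ℝ) ^ p)⁻¹ * T⌋₊,
    weight q Ω T i) / T

/-- At most `q^(-p) T` integers, each of weight at most `weightBound d m (p + 1)`: a domination
uniform in `T`. -/
theorem norm_levelMean_le (hd : 1 ≤ d) (hm : ∀ k ∈ Finset.Icc 1 d, 2 ≤ m k)
    (hanti : AntitoneOn m (Set.Icc 1 d)) (hq : 2 ≤ (q : ℕ)) {Ω : Set (DigitSeq d m)}
    (hne : Ω.Nonempty) {T : ℝ} (hT : 1 ≤ T) (p : ℕ) :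
    ‖levelMean q Ω T p‖ ≤ weightBound d m (p + 1) * (((q : ℕ) : ℝ) ^ p)⁻¹ := by
  have hB := weightBound_nonneg (p := p + 1) hd hm
  have hQ : (0 : ℝ) < ((q : ℕ) : ℝ) := by exact_mod_cast q.pos
  rw [levelMean, norm_div, Real.norm_of_nonneg (by linarith : 0 ≤ T), div_le_iff₀ (by linarith)]
  refine (norm_sum_le_of_le (f := weight q Ω T) _ (n := fun _ => weightBound d m (p + 1)) ?_).trans ?_
  · intro i hi
    obtain ⟨h0, h1⟩ := weight_mem (p := p + 1) hd hm hanti hq hne hT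
      ((Nat.floor_lt (by positivity)).1 (Finset.mem_Ioc.1 hi).1)
    rwa [Real.norm_of_nonneg h0]
  · rw [Finset.sum_const, nsmul_eq_mul, Nat.card_Ioc, mul_comm, mul_assoc]
    refine mul_le_mul_of_nonneg_left ?_ hB
    exact (Nat.cast_le.2 (Nat.sub_le _ _)).trans (Nat.floor_le (by positivity))

theorem summable_weightBound (d : ℕ) (m : ℕ → ℕ) (hq : 2 ≤ (q : ℕ)) :
    Summable fun p : ℕ => weightBound d m (p + 1) * (((q : ℕ) : ℝ) ^ p)⁻¹ := by
  have hQ : (1 : ℝ) < ((q : ℕ) : ℝ) := by exact_mod_cast hq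
  have hr : ‖(((q : ℕ) : ℝ))⁻¹‖ < 1 := by
    rw [norm_inv, Real.norm_of_nonneg (by linarith)]
    exact inv_lt_one_of_one_lt₀ hQ
  have h1 := summable_pow_mul_geometric_of_norm_lt_one 1 hr
  have h2 := summable_pow_mul_geometric_of_norm_lt_one 0 hr
  refine ((h1.add (h2.mul_left 2)).mul_left (d * Real.logb (m d) (m 1))).congr fun p => ?_
  rw [weightBound]
  push_cast
  rw [inv_pow]
  ring

theorem tsum_levelMean (hq : 2 ≤ (q : ℕ)) (Ω : Set (DigitSeq d m)) {T : ℝ} :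
    ∑' p, levelMean q Ω T p = (∑ i ∈ Finset.Ioc 0 ⌊T⌋₊, weight q Ω T i) / T := by
  have hQ : (1 : ℝ) < ((q : ℕ) : ℝ) := by exact_mod_cast hq
  obtain ⟨P, hP⟩ := pow_unbounded_of_one_lt T hQ
  have hzero : ∀ p, P ≤ p → ⌊(((q : ℕ) : ℝ) ^ p)⁻¹ * T⌋₊ = 0 := by
    intro p hp
    rw [Nat.floor_eq_zero, inv_mul_lt_iff₀ (by positivity), mul_one]
    exact hP.trans_le (pow_le_pow_right₀ hQ.le hp)
  have hanti : ∀ p, ⌊(((q : ℕ) : ℝ) ^ (p + 1))⁻¹ * T⌋₊ ≤ ⌊(((q : ℕ) : ℝ) ^ p)⁻¹ * T⌋₊ := by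
    intro p
    rcases le_total 0 T with hT | hT
    · refine Nat.floor_mono (mul_le_mul_of_nonneg_right ?_ hT)
      exact inv_anti₀ (by positivity) (pow_le_pow_right₀ hQ.le (Nat.le_succ p))
    · rw [Nat.floor_of_nonpos (mul_nonpos_of_nonneg_of_nonpos (by positivity) hT)]
      exact Nat.zero_le _
  have hle : ∀ p, ⌊(((q : ℕ) : ℝ) ^ p)⁻¹ * T⌋₊ ≤ ⌊T⌋₊ := by
    intro p
    simpa using antitone_nat_of_succ_le (f := fun p => ⌊(((q : ℕ) : ℝ) ^ p)⁻¹ * T⌋₊) hanti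
      (Nat.zero_le p)
  -- Levels with `q ^ p > T` contain no integer, so the series is finite and its blocks telescope.
  rw [tsum_eq_sum (s := Finset.range P)]
  · simp only [levelMean, ← Finset.sum_div]
    congr 1
    have : ∀ n, ∑ p ∈ Finset.range n,
        ∑ i ∈ Finset.Ioc ⌊(((q : ℕ) : ℝ) ^ (p + 1))⁻¹ * T⌋₊ ⌊(((q : ℕ) : ℝ) ^ p)⁻¹ * T⌋₊,
          weight q Ω T i =
        ∑ i ∈ Finset.Ioc ⌊(((q : ℕ) : ℝ) ^ n)⁻¹ * T⌋₊ ⌊T⌋₊, weight q Ω T i := by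
      intro n
      induction n with
      | zero => simp
      | succ n ih =>
        rw [Finset.sum_range_succ, ih, add_comm, Finset.sum_Ioc_consecutive _ (hanti n) (hle n)]
    rw [this, hzero P le_rfl]
  · intro p hp
    rw [Finset.mem_range, not_lt] at hp
    rw [levelMean, hzero p hp, hzero (p + 1) (by omega), Finset.Ioc_self, Finset.sum_empty, zero_div]

theorem tendsto_sum_weight (hd : 1 ≤ d) (hm : ∀ k ∈ Finset.Icc 1 d, 2 ≤ m k)
    (hanti : AntitoneOn m (Set.Icc 1 d)) (hq : 2 ≤ (q : ℕ)) {Ω : Set (DigitSeq d m)}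
    (hne : Ω.Nonempty) {L : ℕ → ℝ}
    (hL : ∀ p, Tendsto (fun T => levelMean q Ω T p) atTop (𝓝 (L p))) :
    Summable L ∧ Tendsto (fun T => (∑ i ∈ Finset.Ioc 0 (⌊T⌋₊ + 1), weight q Ω T i) / T) atTop
      (𝓝 (∑' p, L p)) := by
  have hsum := summable_weightBound (q := q) d m hq
  have hbound : ∀ᶠ T : ℝ in atTop, ∀ p,
      ‖levelMean q Ω T p‖ ≤ weightBound d m (p + 1) * (((q : ℕ) : ℝ) ^ p)⁻¹ := by
    filter_upwards [eventually_ge_atTop 1] with T hT p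
    exact norm_levelMean_le hd hm hanti hq hne hT p
  refine ⟨hsum.of_norm_bounded fun p => le_of_tendsto (hL p).norm ?_, ?_⟩
  · filter_upwards [hbound] with T hT using hT p
  · have h1 := tendsto_tsum_of_dominated_convergence hsum hL hbound
    have h2 : Tendsto (fun T : ℝ => weight q Ω T (⌊T⌋₊ + 1) / T) atTop (𝓝 0) := by
      refine squeeze_zero_norm' (a := fun T => weightBound d m 0 / T) ?_
        (tendsto_const_nhds.div_atTop tendsto_id)
      filter_upwards [eventually_ge_atTop 1] with T hT
      obtain ⟨h0, h1⟩ := weight_mem (p := 0) (i := ⌊T⌋₊ + 1) hd hm hanti hq hne hT (by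
        push_cast
        rw [pow_zero, inv_one, one_mul]
        exact Nat.lt_floor_add_one T)
      rw [norm_div, Real.norm_of_nonneg (by linarith : 0 ≤ T), Real.norm_of_nonneg h0]
      exact div_le_div_of_nonneg_right h1 (by linarith)
    have h3 := h1.add h2
    rw [add_zero] at h3
    refine h3.congr fun T => ?_
    rw [tsum_levelMean hq, ← add_div, Finset.sum_Ioc_succ_top (Nat.zero_le _)]

theorem hasMinkowskiDim_mulSet (hd : 1 ≤ d) (hm : ∀ k ∈ Finset.Icc 1 d, 2 ≤ m k)
    (hanti : AntitoneOn m (Set.Icc 1 d)) (hq : 2 ≤ (q : ℕ)) {Ω : Set (DigitSeq d m)}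
    (hne : Ω.Nonempty) {D : ℝ}
    (hD : Tendsto (fun T => (∑ i ∈ Finset.Ioc 0 (⌊T⌋₊ + 1), weight q Ω T i) / T) atTop (𝓝 D)) :
    HasMinkowskiDim (mulSet q Ω) D := by
  have hlog := log_digits_pos hm hd le_rfl
  refine ⟨Metric.totallyBounded_of_coveringNumber_ne_top fun ε hε => ?_, ?_⟩
  · rw [coveringNumber_mulSet hd hm hq hne hε
      (M := Finset.univ.sup (radii d m (Real.log (1 / (ε : ℝ)) / Real.log (m d))))
      fun k => Finset.le_sup (Finset.mem_univ k)]
    exact ENat.natCast_ne_top _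
  · have hT : Tendsto (fun ε : ℝ≥0 => Real.log (1 / (ε : ℝ)) / Real.log (m d)) (𝓝[>] 0) atTop := by
      refine Tendsto.atTop_div_const hlog (Real.tendsto_log_atTop.comp ?_)
      simp only [one_div]
      refine tendsto_inv_nhdsGT_zero.comp (tendsto_nhdsWithin_iff.2 ⟨?_, ?_⟩)
      · exact (NNReal.continuous_coe.tendsto 0).mono_left nhdsWithin_le_nhds
      · filter_upwards [self_mem_nhdsWithin] with ε hε
        exact NNReal.coe_pos.2 hε
    refine (hD.comp hT).congr' ?_
    filter_upwards [hT.eventually_ge_atTop 1, self_mem_nhdsWithin] with ε hε1 hε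
    simp only [Function.comp_apply]
    set T := Real.log (1 / (ε : ℝ)) / Real.log (m d) with hTdef
    rw [coveringNumber_mulSet hd hm hq hne hε
      (fun k => radii_le hm hanti (by linarith : 0 ≤ T) k), ENat.toNat_natCast, Nat.cast_prod,
      Real.log_prod, ← hTdef]
    · have hlogT : Real.log (1 / (ε : ℝ)) = T * Real.log (m d) := by
        rw [hTdef]; field_simp
      rw [hlogT, mul_comm T, ← div_div]
      congr 1
      rw [Finset.sum_div, gens, Finset.sum_filter]
      refine Finset.sum_congr (by ext i; simp [Nat.succ_le_iff]) fun i _ => ?_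
      rw [weight, Real.logb, ite_not]
    · intro i hi
      have hi1 := (Finset.mem_Icc.1 (Finset.mem_filter.1 hi).1).1
      have := numRestr_pos hne (finite_of_forall_le (le_of_mem_subPlaces (d := d) hq
        (fun k => radii_le hm hanti (by linarith : 0 ≤ T) k) hi1)).1
      exact_mod_cast this.ne'

end MulSponge

namespace MulSponge

variable {d : ℕ} {m : ℕ → ℕ} {q : ℕ+}

/-! ### The limit on a level -/

/-- `hcell` says that `(a, b]` is a cell on which coordinate `k` is read at exactly `n 1 + ⋯ + n k`
positions. It is required only for `a < b`, since an empty cell has zero weight and its formal size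
may be meaningless. -/
theorem tendsto_cell_pref (hd : 1 ≤ d) (hm : ∀ k ∈ Finset.Icc 1 d, 2 ≤ m k)
    (hanti : AntitoneOn m (Set.Icc 1 d)) (hq : 2 ≤ (q : ℕ)) {Ω : Set (DigitSeq d m)}
    (hne : Ω.Nonempty) {a b : ℝ} {p : ℕ} (hpa : (((q : ℕ) : ℝ) ^ p)⁻¹ ≤ a) (hab : a ≤ b)
    (n : ℕ → ℕ)
    (hcell : a < b → ∀ e k : ℕ, 1 ≤ k → k ≤ d →
      (e < ∑ i ∈ Finset.Icc 1 k, n i → b * ((q : ℕ) : ℝ) ^ e ≤ gamProd d m k) ∧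
      (∑ i ∈ Finset.Icc 1 k, n i ≤ e → gamProd d m k ≤ a * ((q : ℕ) : ℝ) ^ e)) :
    Tendsto (fun T : ℝ => (∑ i ∈ Finset.Ioc ⌊a * T⌋₊ ⌊b * T⌋₊, weight q Ω T i) / T) atTop
      (𝓝 ((b - a) * (1 - 1 / ((q : ℕ) : ℝ)) * Real.logb (m d) ((pref n Ω).ncard : ℝ))) := by
  rcases hab.eq_or_lt with rfl | hlt
  · simp
  have hQ : (0 : ℝ) < ((q : ℕ) : ℝ) := by exact_mod_cast q.pos
  have hplaces : limPlaces d m q b = prefPlaces d n := by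
    ext ⟨c, k⟩
    have hk := Finset.mem_Icc.1 k.2
    obtain ⟨h1, h2⟩ := hcell hlt c.natPred k hk.1 hk.2
    have hc := PNat.natPred_add_one c
    simp only [limPlaces, prefPlaces, Set.mem_ofPred_eq]
    constructor
    · intro h
      by_contra hc'
      refine absurd (h.trans (h2 (by omega))) (not_le.2 ?_)
      gcongr
    · exact fun h => h1 (by omega)
  have h := tendsto_cell hd hm hanti hq hne hpa hlt fun e k h1 hk => by
    rcases lt_or_ge e (∑ i ∈ Finset.Icc 1 k, n i) with he | he
    · exact Or.inl ((hcell hlt e k h1 hk).1 he)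
    · exact Or.inr ((hcell hlt e k h1 hk).2 he)
  rw [hplaces] at h
  exact h

/-- Coordinates with `p ≤ p_k` are not read at all for `i > q^(-p) T`, up to the boundary integer.
-/
theorem gamProd_le_of_le_pPar (hm : ∀ k ∈ Finset.Icc 1 d, 2 ≤ m k)
    (hanti : AntitoneOn m (Set.Icc 1 d)) (hq : 2 ≤ (q : ℕ)) {k p : ℕ} (h1 : 1 ≤ k) (hk : k ≤ d)
    (hp : p ≤ pPar d m q k) (e : ℕ) :
    gamProd d m k ≤ (((q : ℕ) : ℝ) ^ p)⁻¹ * ((q : ℕ) : ℝ) ^ e := by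
  have hQ : (1 : ℝ) ≤ ((q : ℕ) : ℝ) := by exact_mod_cast q.pos
  have hw := wPar_le_one hm hanti hq h1 hk
  have hg := gamProd_pos hm h1 hk
  have h2 : gamProd d m k ≤ (((q : ℕ) : ℝ) ^ p)⁻¹ := by
    rw [le_inv_comm₀ hg (by positivity), ← one_div, le_div_iff₀ hg]
    exact (mul_le_mul_of_nonneg_right (pow_le_pow_right₀ hQ hp) hg.le).trans hw
  exact h2.trans (le_mul_of_one_le_right (by positivity) (one_le_pow₀ hQ))

/-- The whole level is one cell: its endpoints are consecutive powers of `q`, the only thresholds of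
coordinate `d`. -/
theorem tendsto_levelMean_top (hd : 2 ≤ d) (hm : ∀ k ∈ Finset.Icc 1 d, 2 ≤ m k)
    (hanti : AntitoneOn m (Set.Icc 1 d)) (hq : 2 ≤ (q : ℕ)) {Ω : Set (DigitSeq d m)}
    (hne : Ω.Nonempty) {r : ℕ} (hr : r + 1 ≤ pPar d m q (d - 1)) :
    Tendsto (fun T => levelMean q Ω T r) atTop
      (𝓝 (deltaTop q (r + 1) * Real.logb (m d) ((pref (sizeTop d (r + 1)) Ω).ncard : ℝ))) := by
  have hQ : (1 : ℝ) < ((q : ℕ) : ℝ) := by exact_mod_cast hq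
  have hsize : ∀ k ≤ d, ∑ i ∈ Finset.Icc 1 k, sizeTop d (r + 1) i = if k = d then r + 1 else 0 := by
    intro k hk
    split_ifs with hkd
    · simp only [sizeTop, Finset.sum_ite_eq', Finset.mem_Icc]
      rw [if_pos (by omega)]
    · refine Finset.sum_eq_zero fun i hi => ?_
      have := (Finset.mem_Icc.1 hi).2
      rw [sizeTop, if_neg (by omega)]
  have h := tendsto_cell_pref (a := (((q : ℕ) : ℝ) ^ (r + 1))⁻¹) (b := (((q : ℕ) : ℝ) ^ r)⁻¹)
    (p := r + 1) (by omega) hm hanti hq hne le_rfl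
    (inv_anti₀ (by positivity) (pow_le_pow_right₀ hQ.le (Nat.le_succ r)))
    (sizeTop d (r + 1)) (fun _ e k h1 hk => by
      rw [hsize k hk]
      split_ifs with hkd
      · subst hkd
        rw [gamProd_self, inv_mul_le_iff₀ (by positivity), mul_one, inv_mul_eq_div,
          one_le_div (by positivity)]
        exact ⟨fun he => pow_le_pow_right₀ hQ.le (by omega), fun he => pow_le_pow_right₀ hQ.le he⟩
      · refine ⟨fun he => absurd he (by omega), fun _ => ?_⟩
        exact gamProd_le_of_le_pPar hm hanti hq h1 hk
          (hr.trans (pPar_anti hm hanti hq h1 (by omega) (by omega))) e)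
  have hdelta : deltaTop q (r + 1) =
      ((((q : ℕ) : ℝ) ^ r)⁻¹ - (((q : ℕ) : ℝ) ^ (r + 1))⁻¹) * (1 - 1 / ((q : ℕ) : ℝ)) := by
    rw [deltaTop]
    field_simp
    ring
  rw [hdelta]
  exact h

/-- The points that cut the level `(q ^ (-p), q ^ (1 - p)]` into cells. -/
noncomputable def cut (d : ℕ) (m : ℕ → ℕ) (q : ℕ+) (τ : Equiv.Perm ℕ) (s p t : ℕ) : ℝ :=
  (if t < s then 1 else if t < d then ((q : ℕ) : ℝ) * wPar d m q (τ t) else ((q : ℕ) : ℝ)) *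
    (((q : ℕ) : ℝ) ^ p)⁻¹

/-- The interior cuts are ordered by `σ_s`, and `1 < q w ≤ q` keeps them between the ends of the
level. -/
theorem IsOrdering.cut_mono {s : ℕ} {τ : Equiv.Perm ℕ} (h : IsOrdering d m q s τ)
    (hm : ∀ k ∈ Finset.Icc 1 d, 2 ≤ m k) (hanti : AntitoneOn m (Set.Icc 1 d))
    (hq : 2 ≤ (q : ℕ)) (hs : 1 ≤ s) (p : ℕ) : Monotone (cut d m q τ s p) := by
  have hQ : (1 : ℝ) < ((q : ℕ) : ℝ) := by exact_mod_cast hq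
  intro a b hab
  have hmem : ∀ t, s ≤ t → t < d → 1 ≤ τ t ∧ τ t ≤ d := by
    intro t h1 h2
    have := Finset.mem_Icc.1 (h.mem (Finset.mem_Icc.2 ⟨h1, by omega⟩))
    omega
  refine mul_le_mul_of_nonneg_right ?_ (by positivity)
  split_ifs with h1 h2 h3 h4 h5 h6 h7 h8
  · exact le_rfl
  · obtain ⟨h4, h5⟩ := hmem b (by omega) h3
    exact (one_lt_mul_wPar hm hq h4 h5).le
  · exact hQ.le
  · omega
  · exact mul_le_mul_of_nonneg_left
      (h.wPar_mono hm hs ⟨by omega, by omega⟩ ⟨by omega, by omega⟩ hab) (by positivity)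
  · obtain ⟨h6, h7⟩ := hmem a (by omega) h4
    exact mul_le_of_le_one_right (by positivity) (wPar_le_one hm hanti hq h6 h7)
  · omega
  · omega
  · exact le_rfl

theorem delta_eq (hd : 2 ≤ d) (σ : ℕ → Equiv.Perm ℕ) {s t p : ℕ} (hs : 1 ≤ s) (hsd : s ≤ d - 1)
    (ht : s - 1 ≤ t) (htd : t ≤ d - 1) :
    delta d m q σ s t p =
      (cut d m q (σ s) s p (t + 1) - cut d m q (σ s) s p t) * (1 - 1 / ((q : ℕ) : ℝ)) := by
  have hQ : (0 : ℝ) < ((q : ℕ) : ℝ) := by exact_mod_cast q.pos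
  simp only [delta, cut, wPar]
  by_cases h1 : t + 1 = s
  · subst h1
    simp only [if_true, lt_irrefl, if_false, Nat.lt_succ_self]
    rw [if_pos (by omega)]
    field_simp
    ring
  · rw [if_neg h1, if_neg (by omega : ¬ t + 1 < s), if_neg (by omega : ¬ t < s),
      if_pos (by omega : t < d)]
    by_cases h2 : t = d - 1
    · subst h2
      rw [if_pos rfl, if_neg (by omega)]
      field_simp
    · rw [if_neg h2, if_pos (by omega)]
      field_simp

/-- The entries telescope; the two hypotheses make the truncated subtractions exact. -/
theorem sum_sizeST (σ : ℕ → Equiv.Perm ℕ) {s t p : ℕ} (hs : 1 ≤ s) (hsd : s ≤ d - 1)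
    (hp : ∀ k, s ≤ k → k ≤ d - 1 → pST d m q σ s t k ≤ p)
    (hmono : ∀ k, s ≤ k → k + 1 ≤ d - 1 → pST d m q σ s t (k + 1) ≤ pST d m q σ s t k)
    {k : ℕ} (hk : k ≤ d) :
    ∑ i ∈ Finset.Icc 1 k, sizeST d m q σ s t p i =
      if k < s then 0 else if k < d then p - pST d m q σ s t k else p := by
  induction k with
  | zero =>
    rw [if_pos (by omega)]
    simp
  | succ k ih =>
    rw [Finset.sum_Icc_succ_top (by omega), ih (by omega)]
    simp only [sizeST]
    rcases lt_trichotomy (k + 1) s with h1 | h1 | h1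
    · rw [if_pos h1, if_pos (by omega), if_pos h1]
    · subst h1
      simp only [lt_irrefl, if_false, if_true, Nat.lt_succ_self]
      rw [if_pos (by omega), zero_add]
    · have hpk := hp k (by omega) (by omega)
      rcases hk.eq_or_lt with rfl | h2
      · rw [Nat.add_sub_cancel]
        split_ifs <;> omega
      · have := hmono k (by omega) (by omega)
        rw [Nat.add_sub_cancel]
        split_ifs <;> omega

/-- Let `k = σ_s(u)` and `c = p - p_k - 1`. Then `g_k` is the `u`-th cut times `q^c`. If the cell
lies above that cut (`u ≤ t`), exactly the exponents `e < c` are read; if below, those with `e ≤ c`.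
This is the count `p - p_k^{s,t}`. -/
theorem cell_bounds (hm : ∀ k ∈ Finset.Icc 1 d, 2 ≤ m k)
    (hanti : AntitoneOn m (Set.Icc 1 d)) (hq : 2 ≤ (q : ℕ)) {σ : ℕ → Equiv.Perm ℕ} {s t p : ℕ}
    (hs : 1 ≤ s) (hsd : s ≤ d - 1) (hσ : IsOrdering d m q s (σ s))
    (hp : pPar d m q s < p) (hps : ∀ k, 1 ≤ k → k < s → p ≤ pPar d m q k)
    (htd : t ≤ d - 1)
    (hlt : cut d m q (σ s) s p t < cut d m q (σ s) s p (t + 1)) (e : ℕ) {k : ℕ} (h1 : 1 ≤ k)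
    (hk : k ≤ d) :
    (e < ∑ i ∈ Finset.Icc 1 k, sizeST d m q σ s t p i →
      cut d m q (σ s) s p (t + 1) * ((q : ℕ) : ℝ) ^ e ≤ gamProd d m k) ∧
    (∑ i ∈ Finset.Icc 1 k, sizeST d m q σ s t p i ≤ e →
      gamProd d m k ≤ cut d m q (σ s) s p t * ((q : ℕ) : ℝ) ^ e) := by
  have hQ : (1 : ℝ) < ((q : ℕ) : ℝ) := by exact_mod_cast hq
  have hcut := hσ.cut_mono hm hanti hq hs p
  have hrank : ∀ k, s ≤ k → k ≤ d - 1 → ∃ u, s ≤ u ∧ u ≤ d - 1 ∧ σ s u = k ∧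
      cut d m q (σ s) s p u = ((q : ℕ) : ℝ) * wPar d m q k * (((q : ℕ) : ℝ) ^ p)⁻¹ ∧
      pST d m q σ s t k = if u ≤ t then pPar d m q k + 1 else pPar d m q k := by
    intro k h1 h2
    obtain ⟨u, rfl⟩ := (σ s).surjective k
    have hu : u ∈ Finset.Icc s (d - 1) := by
      by_contra hu
      rw [hσ.fix u hu] at h1 h2
      exact hu (Finset.mem_Icc.2 ⟨h1, h2⟩)
    rw [Finset.mem_Icc] at hu
    refine ⟨u, hu.1, hu.2, rfl, ?_, ?_⟩
    · rw [cut, if_neg (by omega), if_pos (by omega)]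
    · rw [pST]
      refine if_congr ?_ rfl rfl
      rw [Finset.mem_image]
      constructor
      · rintro ⟨v, hv, hvu⟩
        rw [← (σ s).injective hvu]
        exact (Finset.mem_Icc.1 hv).2
      · exact fun h => ⟨u, Finset.mem_Icc.2 ⟨hu.1, h⟩, rfl⟩
  have hanti' : ∀ k l, s ≤ k → k ≤ l → l ≤ d - 1 → pPar d m q l ≤ pPar d m q k :=
    fun k l h1 h2 h3 => pPar_anti hm hanti hq (by omega) h2 (by omega)
  have hpST : ∀ k, s ≤ k → k ≤ d - 1 → pST d m q σ s t k ≤ p := by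
    intro k h1 h2
    obtain ⟨u, -, -, -, -, hu⟩ := hrank k h1 h2
    have := hanti' s k le_rfl h1 h2
    rw [hu]
    split_ifs <;> omega
  have hmono : ∀ k, s ≤ k → k + 1 ≤ d - 1 → pST d m q σ s t (k + 1) ≤ pST d m q σ s t k := by
    intro k h1 h2
    obtain ⟨u, -, -, -, hcu, hu⟩ := hrank k h1 (by omega)
    obtain ⟨v, -, -, -, hcv, hv⟩ := hrank (k + 1) (by omega) h2
    have hle := hanti' k (k + 1) h1 (by omega) h2
    rw [hu, hv]
    split_ifs with h3 h4 h4
    · omega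
    · rcases hle.lt_or_eq with h5 | h5
      · omega
      -- If `p_k = p_{k+1}`, then `w_k ≤ w_{k+1}`; having `k + 1` but not `k` among the first cuts
      -- would force the cell to be empty.
      · exfalso
        have hw : wPar d m q k ≤ wPar d m q (k + 1) := by
          rw [wPar, wPar, h5]
          exact mul_le_mul_of_nonneg_left
            (gamProd_mono hm hanti (by omega) (by omega) (by omega)) (by positivity)
        have h6 : cut d m q (σ s) s p u ≤ cut d m q (σ s) s p v := by
          rw [hcu, hcv]
          gcongr
        exact absurd hlt (not_lt.2 (((hcut (by omega : t + 1 ≤ u)).trans h6).trans (hcut h3)))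
    · omega
    · exact hle
  have hlow : (((q : ℕ) : ℝ) ^ p)⁻¹ ≤ cut d m q (σ s) s p t := by
    refine le_trans (le_of_eq ?_) (hcut (Nat.zero_le t))
    rw [cut, if_pos (by omega), one_mul]
  have hup : cut d m q (σ s) s p (t + 1) ≤ ((q : ℕ) : ℝ) * (((q : ℕ) : ℝ) ^ p)⁻¹ := by
    refine (hcut (by omega : t + 1 ≤ d)).trans_eq ?_
    rw [cut, if_neg (by omega), if_neg (by omega)]
  have hQe : (0 : ℝ) < ((q : ℕ) : ℝ) ^ e := by positivity
  rw [sum_sizeST σ hs hsd hpST hmono hk]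
  split_ifs with h2 h3
  · exact ⟨fun he => absurd he (by omega), fun _ =>
      (gamProd_le_of_le_pPar hm hanti hq h1 hk (hps k h1 h2) e).trans (by gcongr)⟩
  · obtain ⟨u, -, -, -, hcu, hu⟩ := hrank k (by omega) (by omega)
    have hpk := hanti' s k le_rfl (by omega) (by omega)
    have hw0 : 0 < wPar d m q k := wPar_pos hm h1 hk
    have hg : gamProd d m k = wPar d m q k * (((q : ℕ) : ℝ) ^ pPar d m q k)⁻¹ := by
      rw [wPar]; field_simp
    rw [hu, hg]
    obtain ⟨c, hc⟩ : ∃ c, p = pPar d m q k + c + 1 := ⟨p - pPar d m q k - 1, by omega⟩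
    have hpinv : (((q : ℕ) : ℝ) ^ p)⁻¹ =
        (((q : ℕ) : ℝ) ^ pPar d m q k)⁻¹ * (((q : ℕ) : ℝ) ^ (c + 1))⁻¹ := by
      rw [hc, add_assoc, pow_add _ (pPar d m q k), mul_inv]
    have hP : (0 : ℝ) < (((q : ℕ) : ℝ) ^ pPar d m q k)⁻¹ := by positivity
    split_ifs with h4
    · constructor
      · intro he
        have he' : e + 1 ≤ c := by omega
        -- The upper end of the whole level is enough here, because `1/q < w_k`.
        calc _ ≤ ((q : ℕ) : ℝ) * (((q : ℕ) : ℝ) ^ p)⁻¹ * ((q : ℕ) : ℝ) ^ e := by gcongr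
          _ = ((q : ℕ) : ℝ) ^ (e + 1) * (((q : ℕ) : ℝ) ^ (c + 1))⁻¹ *
              (((q : ℕ) : ℝ) ^ pPar d m q k)⁻¹ := by rw [hpinv]; ring
          _ ≤ ((q : ℕ) : ℝ) ^ c * (((q : ℕ) : ℝ) ^ (c + 1))⁻¹ *
              (((q : ℕ) : ℝ) ^ pPar d m q k)⁻¹ := by
                gcongr
                exact hQ.le
          _ ≤ wPar d m q k * (((q : ℕ) : ℝ) ^ pPar d m q k)⁻¹ := by
                refine mul_le_mul_of_nonneg_right ?_ hP.le
                have := one_lt_mul_wPar hm hq h1 hk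
                rw [pow_succ, mul_inv, ← mul_assoc, mul_inv_cancel₀ (by positivity), one_mul,
                  inv_le_iff_one_le_mul₀ (by positivity), mul_comm]
                exact this.le
      · intro he
        have he' : c ≤ e := by omega
        calc _ ≤ wPar d m q k * (((q : ℕ) : ℝ) ^ pPar d m q k)⁻¹ *
              (((q : ℕ) : ℝ) ^ e * (((q : ℕ) : ℝ) ^ c)⁻¹) := by
                refine le_mul_of_one_le_right (by positivity) ?_
                rw [← div_eq_mul_inv, one_le_div (by positivity)]
                exact pow_le_pow_right₀ hQ.le he'
          _ = cut d m q (σ s) s p u * ((q : ℕ) : ℝ) ^ e := by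
                rw [hcu, hpinv, pow_succ]
                field_simp
          _ ≤ _ := mul_le_mul_of_nonneg_right (hcut h4) hQe.le
    · constructor
      · intro he
        have he' : e ≤ c := by omega
        calc _ ≤ cut d m q (σ s) s p u * ((q : ℕ) : ℝ) ^ e :=
                mul_le_mul_of_nonneg_right (hcut (by omega)) hQe.le
          _ = wPar d m q k * (((q : ℕ) : ℝ) ^ pPar d m q k)⁻¹ *
              (((q : ℕ) : ℝ) ^ e * (((q : ℕ) : ℝ) ^ c)⁻¹) := by
                rw [hcu, hpinv, pow_succ]
                field_simp
          _ ≤ _ := by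
                refine mul_le_of_le_one_right (by positivity) ?_
                rw [← div_eq_mul_inv, div_le_one (by positivity)]
                exact pow_le_pow_right₀ hQ.le he'
      · intro he
        have he' : c + 1 ≤ e := by omega
        -- Here the lower end of the level is enough, because `w_k ≤ 1`.
        calc _ ≤ 1 * (((q : ℕ) : ℝ) ^ pPar d m q k)⁻¹ *
              (((q : ℕ) : ℝ) ^ e * (((q : ℕ) : ℝ) ^ (c + 1))⁻¹) := by
                rw [one_mul]
                refine le_trans (mul_le_of_le_one_left hP.le (wPar_le_one hm hanti hq h1 hk)) ?_
                refine le_mul_of_one_le_right hP.le ?_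
                rw [← div_eq_mul_inv, one_le_div (by positivity)]
                exact pow_le_pow_right₀ hQ.le he'
          _ = (((q : ℕ) : ℝ) ^ p)⁻¹ * ((q : ℕ) : ℝ) ^ e := by rw [hpinv]; ring
          _ ≤ _ := by gcongr
  · have : k = d := by omega
    subst this
    rw [gamProd_self]
    constructor
    · intro he
      obtain ⟨r, rfl⟩ : ∃ r, p = r + 1 := ⟨p - 1, by omega⟩
      refine (mul_le_mul_of_nonneg_right hup hQe.le).trans ?_
      rw [pow_succ', mul_inv, ← mul_assoc, mul_inv_cancel₀ (by positivity), one_mul,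
        inv_mul_le_iff₀ (by positivity), mul_one]
      exact pow_le_pow_right₀ hQ.le (by omega)
    · intro he
      refine le_trans ?_ (mul_le_mul_of_nonneg_right hlow hQe.le)
      rw [inv_mul_eq_div, one_le_div (by positivity)]
      exact pow_le_pow_right₀ hQ.le he

theorem sum_sum_Ioc_consecutive {M : Type*} [AddCommMonoid M] (f : ℕ → M) {B : ℕ → ℕ}
    (hB : Monotone B) {a b : ℕ} (hab : a ≤ b) :
    ∑ t ∈ Finset.Ico a b, ∑ i ∈ Finset.Ioc (B t) (B (t + 1)), f i =
      ∑ i ∈ Finset.Ioc (B a) (B b), f i := by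
  induction b, hab using Nat.le_induction with
  | base => simp
  | succ b hab ih =>
    rw [Finset.sum_Ico_succ_top hab, ih, Finset.sum_Ioc_consecutive _ (hB hab) (hB (Nat.le_succ b))]

theorem tendsto_levelMean (hm : ∀ k ∈ Finset.Icc 1 d, 2 ≤ m k)
    (hanti : AntitoneOn m (Set.Icc 1 d)) (hq : 2 ≤ (q : ℕ)) {Ω : Set (DigitSeq d m)}
    (hne : Ω.Nonempty) {σ : ℕ → Equiv.Perm ℕ} {s r : ℕ}
    (hs : 1 ≤ s) (hsd : s ≤ d - 1) (hσ : IsOrdering d m q s (σ s))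
    (hp : pPar d m q s < r + 1) (hps : ∀ k, 1 ≤ k → k < s → r + 1 ≤ pPar d m q k) :
    Tendsto (fun T => levelMean q Ω T r) atTop (𝓝 (levelSum q σ Ω s (r + 1))) := by
  have hQ : (1 : ℝ) < ((q : ℕ) : ℝ) := by exact_mod_cast hq
  have hcut := hσ.cut_mono hm hanti hq hs (r + 1)
  have hlow : (((q : ℕ) : ℝ) ^ (r + 1))⁻¹ = cut d m q (σ s) s (r + 1) (s - 1) := by
    rw [cut, if_pos (by omega), one_mul]
  have hup : (((q : ℕ) : ℝ) ^ r)⁻¹ = cut d m q (σ s) s (r + 1) d := by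
    rw [cut, if_neg (by omega), if_neg (by omega), pow_succ', mul_inv, ← mul_assoc,
      mul_inv_cancel₀ (by positivity), one_mul]
  have hIcc : Finset.Icc (s - 1) (d - 1) = Finset.Ico (s - 1) d := by
    ext; simp only [Finset.mem_Icc, Finset.mem_Ico]; omega
  have h : Tendsto (fun T : ℝ => ∑ t ∈ Finset.Icc (s - 1) (d - 1),
      (∑ i ∈ Finset.Ioc ⌊cut d m q (σ s) s (r + 1) t * T⌋₊
        ⌊cut d m q (σ s) s (r + 1) (t + 1) * T⌋₊, weight q Ω T i) / T) atTop
      (𝓝 (levelSum q σ Ω s (r + 1))) := by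
    refine tendsto_finsetSum _ fun t ht => ?_
    rw [Finset.mem_Icc] at ht
    rw [delta_eq (by omega) σ hs hsd ht.1 ht.2]
    refine tendsto_cell_pref (p := r + 1) (by omega) hm hanti hq hne (hlow.trans_le (hcut ht.1))
      (hcut (Nat.le_succ t)) _ fun hlt e k h1 hk => ?_
    exact cell_bounds hm hanti hq hs hsd hσ hp hps ht.2 hlt e h1 hk
  refine h.congr' ?_
  filter_upwards [eventually_ge_atTop 0] with T hT
  rw [levelMean, ← Finset.sum_div, hIcc, hlow, hup]
  congr 1
  exact sum_sum_Ioc_consecutive (weight q Ω T)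
    (fun a b hab => Nat.floor_mono (mul_le_mul_of_nonneg_right (hcut hab) hT)) (by omega)

/-! ### Assembling the levels -/

theorem sum_Icc_eq_add_sum_levels {M : Type*} [AddCommMonoid M] (f : ℕ → M) {P : ℕ → ℕ} {u : ℕ}
    (hu : 1 ≤ u) (hP : ∀ s, 2 ≤ s → s ≤ u → P s ≤ P (s - 1)) :
    ∑ p ∈ Finset.Icc 1 (P 1), f p = ∑ p ∈ Finset.Icc 1 (P u), f p +
      ∑ s ∈ Finset.Icc 2 u, ∑ p ∈ Finset.Icc (P s + 1) (P (s - 1)), f p := by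
  induction u, hu using Nat.le_induction with
  | base => simp
  | succ u hu ih =>
    have h := hP (u + 1) (by omega) le_rfl
    rw [Nat.add_sub_cancel] at h
    rw [ih fun s h1 h2 => hP s h1 (by omega), Finset.sum_Icc_succ_top (by omega),
      Nat.add_sub_cancel, add_comm (∑ s ∈ Finset.Icc 2 u, _), ← add_assoc]
    congr 1
    have hIoc : ∀ a b : ℕ, Finset.Icc (a + 1) b = Finset.Ioc a b := fun a b => by
      ext; simp
    rw [hIoc, ← zero_add 1, hIoc, hIoc]
    exact (Finset.sum_Ioc_consecutive f (Nat.zero_le _) h).symm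

end MulSponge

open MulSponge
theorem mainTheorem11 (d : ℕ) (hd : 2 ≤ d) (m : ℕ → ℕ)
    (hm : ∀ k ∈ Finset.Icc 1 d, 2 ≤ m k) (hanti : AntitoneOn m (Set.Icc 1 d))
    (q : ℕ+) (hq : 2 ≤ (q : ℕ))
    (Ω : Set (DigitSeq d m)) (hΩ : IsClosed Ω) (hne : Ω.Nonempty) :
    (∀ s ∈ Finset.Icc 1 (d - 1), ∃ τ, IsOrdering d m q s τ) ∧
    ∀ σ : ℕ → Equiv.Perm ℕ, (∀ s ∈ Finset.Icc 1 (d - 1), IsOrdering d m q s (σ s)) →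
      Summable (fun r : ℕ => levelSum q σ Ω 1 (pPar d m q 1 + 1 + r)) ∧
      HasMinkowskiDim (mulSet q Ω)
        ((∑ p ∈ Finset.Icc 1 (jPar m q d),
            deltaTop q p * Real.logb (m d) ((pref (sizeTop d p) Ω).ncard : ℝ)) +
          (∑ s ∈ Finset.Icc 2 (d - 1),
            ∑ p ∈ Finset.Icc (pPar d m q s + 1) (pPar d m q (s - 1)), levelSum q σ Ω s p) +
          ∑' r : ℕ, levelSum q σ Ω 1 (pPar d m q 1 + 1 + r)) := by
  refine ⟨fun s hs => exists_isOrdering hm hs, fun σ hσ => ?_⟩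
  have hd1 : 1 ≤ d := by omega
  have htop : ∀ r, r + 1 ≤ pPar d m q (d - 1) → Tendsto (fun T => levelMean q Ω T r) atTop
      (𝓝 (deltaTop q (r + 1) * Real.logb (m d) ((pref (sizeTop d (r + 1)) Ω).ncard : ℝ))) :=
    fun r hr => tendsto_levelMean_top hd hm hanti hq hne hr
  have hmid : ∀ s r, 2 ≤ s → s ≤ d - 1 → pPar d m q s < r + 1 → r + 1 ≤ pPar d m q (s - 1) →
      Tendsto (fun T => levelMean q Ω T r) atTop (𝓝 (levelSum q σ Ω s (r + 1))) :=
    fun s r h1 h2 h3 h4 => tendsto_levelMean hm hanti hq hne (by omega) h2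
      (hσ s (Finset.mem_Icc.2 ⟨by omega, h2⟩)) h3 fun k hk hks =>
        h4.trans (pPar_anti hm hanti hq hk (by omega) (by omega))
  have hlast : ∀ r, pPar d m q 1 < r + 1 →
      Tendsto (fun T => levelMean q Ω T r) atTop (𝓝 (levelSum q σ Ω 1 (r + 1))) :=
    fun r hr => tendsto_levelMean hm hanti hq hne le_rfl (by omega)
      (hσ 1 (Finset.mem_Icc.2 ⟨le_rfl, by omega⟩)) hr fun k hk hk1 => by omega
  have hex : ∀ r, ∃ L, Tendsto (fun T => levelMean q Ω T r) atTop (𝓝 L) := by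
    intro r
    by_cases h1 : pPar d m q 1 < r + 1
    · exact ⟨_, hlast r h1⟩
    -- Search for the index `u` with `p_{u+1} < r + 1 ≤ p_u`; if none occurs up to `d - 1`, the
    -- level is one where coordinate `d` alone is read.
    have hfind : ∀ u, 1 ≤ u → u ≤ d - 1 → r + 1 ≤ pPar d m q u ∨
        ∃ L, Tendsto (fun T => levelMean q Ω T r) atTop (𝓝 L) := by
      intro u hu
      induction u, hu using Nat.le_induction with
      | base => exact fun _ => Or.inl (not_lt.1 h1)
      | succ u hu ih =>
        intro hud
        rcases ih (by omega) with h | h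
        · rcases le_or_gt (r + 1) (pPar d m q (u + 1)) with h' | h'
          · exact Or.inl h'
          · exact Or.inr ⟨_, hmid (u + 1) r (by omega) hud h' h⟩
        · exact Or.inr h
    rcases hfind (d - 1) (by omega) le_rfl with h | h
    · exact ⟨_, htop r h⟩
    · exact h
  choose L hL using hex
  obtain ⟨hsum, hlim⟩ := tendsto_sum_weight hd1 hm hanti hq hne hL
  have htail : ∀ r, L (r + pPar d m q 1) = levelSum q σ Ω 1 (pPar d m q 1 + 1 + r) := by
    intro r
    rw [show pPar d m q 1 + 1 + r = r + pPar d m q 1 + 1 by omega]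
    exact tendsto_nhds_unique (hL _) (hlast _ (by omega))
  refine ⟨((summable_nat_add_iff (pPar d m q 1)).2 hsum).congr htail, ?_⟩
  convert hasMinkowskiDim_mulSet hd1 hm hanti hq hne hlim using 1
  -- Splits at `p_1`; as `L r` belongs to level `r + 1`, the tail starts at level `p_1 + 1`.
  -- Uniqueness of limits identifies each `L r` with its term in the formula.
  rw [← hsum.sum_add_tsum_nat_add (pPar d m q 1), tsum_congr htail]
  congr 1
  have hshift : ∑ r ∈ Finset.range (pPar d m q 1), L r =
      ∑ p ∈ Finset.Icc 1 (pPar d m q 1), L (p - 1) := by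
    rw [Finset.range_eq_Ico, ← Finset.Ico_add_one_right_eq_Icc,
      Finset.sum_Ico_eq_sum_range, Finset.sum_Ico_eq_sum_range]
    simp
  rw [hshift, sum_Icc_eq_add_sum_levels (fun p => L (p - 1)) (P := pPar d m q) (u := d - 1)
    (by omega) fun s h1 h2 => pPar_anti hm hanti hq (by omega) (by omega) (by omega), jPar_eq hd]
  congr 1
  · refine Finset.sum_congr rfl fun p hp => ?_
    obtain ⟨h1, h2⟩ := Finset.mem_Icc.1 hp
    obtain ⟨r, rfl⟩ : ∃ r, p = r + 1 := ⟨p - 1, by omega⟩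
    exact tendsto_nhds_unique (htop r h2) (hL r)
  · refine Finset.sum_congr rfl fun s hs => Finset.sum_congr rfl fun p hp => ?_
    obtain ⟨h1, h2⟩ := Finset.mem_Icc.1 hp
    rw [Finset.mem_Icc] at hs
    obtain ⟨r, rfl⟩ : ∃ r, p = r + 1 := ⟨p - 1, by omega⟩
    exact tendsto_nhds_unique (hmid s r hs.1 hs.2 (by omega) h2) (hL r)
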